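/- Let $T,I$ be integers with $0<I\le T/2$ and let $n\ge 2$. A configuration is a vector $r=(r_1,\dots,r_{n-1})\in\mathbb Z^{n-1}$; it is stable if $r_k\le T$ for all $k$. The stochastic sandpile SSP with input $r$ repeats the following as long as the configuration is not stable: choose any $k$ with $r_k>T$, sample $\gamma$ uniformly from $\{1,\dots,I\}$ independently of the past, replace $r_k$ by $r_k-2\gamma$, and add $\gamma$ to $r_{k-1}$ (if $k>1$) and to $r_{k+1}$ (if $k<n-1$). It always terminates, and the distribution of its output does not depend on how $k$ is chosen. For probability distributions $g,f$ on configurations, let $g\oplus f$ be the distribution of the output of SSP with input $r+s$, where $r\sim g$ and $s\sim f$ are independent. A steady state is a distribution $g$ with $g\oplus f=g$ for every finitely supported distribution $f$ on nonnegative configurations. Put $$\log\mathrm{RHF}(r)=\frac1{n^2}\sum_{i=1}^{n-1}(n-i)\,r_i .$$ The worst case of $\mathrm{RHF}$ or $\log\mathrm{RHF}$ is its maximum over all possible outputs of SSP (over all inputs); the average is its expectation under the steady state. **Theorem.** 1. For all $T,I,n$ as above, SSP has a unique steady state, and this steady state is mixed: it is finitely supported, on at least two configurations. 2. For fixed $T,I$,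 the worst-case $\log\mathrm{RHF}$ is $T/2+o_n(1)$ as $n\to\infty$. 3. There is an absolute constant $I_0$ such that, for all fixed $T,I$ with $I\ge I_0$, the average $\log\mathrm{RHF}$ is at most $T/2-\dfrac{I}{2e^2}+o_n(1)$ as $n\to\infty$. 4. For all fixed $T,I$ with $I\ge 2$ there is $c>0$ such that, for all sufficiently large $n$, the average $\mathrm{RHF}$ is at most the worst-case $\mathrm{RHF}$ minus $c$. -/

import Mathlib

namespace SSP

/-- The parameters of the stochastic sandpile: threshold `T` and maximal increment `I`,
integers with `0 < I ≤ T / 2`. -/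
structure Params where
  T : ℤ
  I : ℤ
  I_pos : 0 < I
  two_mul_I_le : 2 * I ≤ T

/-- A configuration of system size `n`: an integer height at each of the `n - 1` non-sink
vertices `v_1, …, v_{n-1}`. The index `i : Fin (n - 1)` stands for the vertex `v_{i+1}`. -/
abbrev Config (n : ℕ) : Type := Fin (n - 1) → ℤ

variable {n : ℕ}

/-- Toppling the amount `γ` at `k`: the vertex `k` loses `2γ`, each of its neighbours gains `γ`
(what would go to the sink is discarded). -/
def topple (r : Config n) (k : Fin (n - 1)) (γ : ℤ) : Config n := fun j =>
  if j = k then r j - 2 * γ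
  else if j.val + 1 = k.val ∨ k.val + 1 = j.val then r j + γ
  else r j

def Stable (P : Params) (r : Config n) : Prop := ∀ k, r k ≤ P.T

theorem increments_nonempty (P : Params) : (Finset.Icc 1 P.I).Nonempty :=
  ⟨1, Finset.mem_Icc.2 ⟨le_rfl, P.I_pos⟩⟩

/-- The random increment: uniform on `{1, …, I}`. -/
noncomputable def increment (P : Params) : PMF ℤ :=
  PMF.uniformOfFinset (Finset.Icc 1 P.I) (increments_nonempty P)

/-- `IsOutput P r μ`: the stochastic sandpile algorithm, started at `r` and choosing the unstable
vertex to be toppled in some arbitrary way at every step (possibly depending on the history),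
terminates and its output has the distribution `μ`. -/
inductive IsOutput (P : Params) : Config n → PMF (Config n) → Prop
  | stable {r : Config n} (h : Stable P r) : IsOutput P r (PMF.pure r)
  | topple {r : Config n} (k : Fin (n - 1)) (hk : P.T < r k) (ν : ℤ → PMF (Config n))
      (h : ∀ γ ∈ Finset.Icc 1 P.I, IsOutput P (topple r k γ) (ν γ)) :
      IsOutput P r ((increment P).bind ν)

section WellDefined

/-- Quadratic weights, whose discrete Laplacian is constant. -/
def weight (j : Fin (n - 1)) : ℤ := ((j.val : ℤ) + 1) * ((n : ℤ) - 1 - j.val)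

theorem weight_nonneg (j : Fin (n - 1)) : 0 ≤ weight j := by
  have := j.isLt
  unfold weight
  apply mul_nonneg <;> omega

theorem topple_eq (r : Config n) (k : Fin (n - 1)) (γ : ℤ) (j : Fin (n - 1)) :
    topple r k γ j = r j + γ * ((if j.val + 1 = k.val then 1 else 0)
      + (if k.val + 1 = j.val then 1 else 0) - 2 * (if j = k then 1 else 0)) := by
  unfold topple
  by_cases h : j = k
  · subst h; simp; ring
  · by_cases h1 : j.val + 1 = k.val
    · have h2 : ¬ (k.val + 1 = j.val) := by omega
      simp [h, h1, h2]
    · by_cases h2 : k.val + 1 = j.val <;> simp [h, h1, h2]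

theorem topple_comm (r : Config n) (k l : Fin (n - 1)) (γ γ' : ℤ) :
    topple (topple r k γ) l γ' = topple (topple r l γ') k γ := by
  funext j
  simp only [topple_eq]
  ring

theorem le_topple_of_ne (r : Config n) {k l : Fin (n - 1)} (h : l ≠ k) {γ : ℤ} (hγ : 0 ≤ γ) :
    r l ≤ topple r k γ l := by
  unfold topple
  rw [if_neg h]
  split_ifs <;> omega

theorem sum_weight_left (k : Fin (n - 1)) :
    ∑ j : Fin (n - 1), weight j * (if j.val + 1 = k.val then 1 else 0)
      = (k.val : ℤ) * ((n : ℤ) - k.val) := by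
  by_cases h : k.val = 0
  · rw [Finset.sum_eq_zero]
    · simp [h]
    · intro j _
      rw [if_neg (by omega)]; simp
  · have hk := k.isLt
    rw [Finset.sum_eq_single (⟨k.val - 1, by omega⟩ : Fin (n - 1))]
    · have : k.val - 1 + 1 = k.val := by omega
      have h' : ((k.val - 1 : ℕ) : ℤ) = (k.val : ℤ) - 1 := by omega
      simp only [this, if_true, weight, h']
      ring
    · intro j _ hj
      rw [if_neg]
      · simp
      · intro hh; apply hj; ext; simp; omega
    · simp

theorem sum_weight_right (k : Fin (n - 1)) :
    ∑ j : Fin (n - 1), weight j * (if k.val + 1 = j.val then 1 else 0)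
      = ((k.val : ℤ) + 2) * ((n : ℤ) - 2 - k.val) := by
  have hk := k.isLt
  by_cases h : k.val + 1 < n - 1
  · rw [Finset.sum_eq_single (⟨k.val + 1, h⟩ : Fin (n - 1))]
    · simp only [if_true, weight]
      push_cast
      ring
    · intro j _ hj
      rw [if_neg]
      · simp
      · intro hh; apply hj; ext; simp; omega
    · simp
  · rw [Finset.sum_eq_zero]
    · have : (n : ℤ) - 2 - k.val = 0 := by omega
      simp [this]
    · intro j _
      have := j.isLt
      rw [if_neg (by omega)]; simp

/-- A toppling of amount `γ` lowers the weighted total height by exactly `2γ`. -/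
theorem sum_weight_topple (r : Config n) (k : Fin (n - 1)) (γ : ℤ) :
    ∑ j, weight j * topple r k γ j = ∑ j, weight j * r j - 2 * γ := by
  have e : ∀ j, weight j * topple r k γ j = weight j * r j
      + γ * (weight j * (if j.val + 1 = k.val then 1 else 0))
      + γ * (weight j * (if k.val + 1 = j.val then 1 else 0))
      - 2 * γ * (weight j * (if j = k then 1 else 0)) := by
    intro j; rw [topple_eq]; ring
  simp only [e, Finset.sum_add_distrib, Finset.sum_sub_distrib, ← Finset.mul_sum,
    sum_weight_left, sum_weight_right]
  simp [weight]
  ring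

/-- Whatever the order of the topplings, the algorithm terminates, and the distribution of its
output does not depend on that order. -/
theorem existsUnique_isOutput (P : Params) (r : Config n) : ∃! μ, IsOutput P r μ := by
  obtain ⟨L, hLT, hL⟩ : ∃ L : ℤ, L ≤ P.T - 2 * P.I ∧ ∀ j, L ≤ r j := by
    refine ⟨-∑ j, |r j|, ?_, fun j => ?_⟩
    · have h1 : 0 ≤ ∑ j, |r j| := Finset.sum_nonneg fun j _ => abs_nonneg _
      have h2 := P.two_mul_I_le
      omega
    · have h1 : |r j| ≤ ∑ j, |r j| :=
        Finset.single_le_sum (f := fun j => |r j|) (fun j _ => abs_nonneg _) (Finset.mem_univ j)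
      have h2 := neg_abs_le (r j)
      omega
  suffices H : ∀ (N : ℕ) (r : Config n), (∀ j, L ≤ r j) →
      ∑ j, weight j * r j - ∑ j : Fin (n - 1), weight j * L < N → ∃! μ, IsOutput P r μ by
    refine H (∑ j, weight j * r j - ∑ j : Fin (n - 1), weight j * L + 1).toNat r hL ?_
    omega
  intro N
  induction N with
  | zero =>
    intro r hr h
    exfalso
    have : ∑ j : Fin (n - 1), weight j * L ≤ ∑ j, weight j * r j :=
      Finset.sum_le_sum fun j _ => mul_le_mul_of_nonneg_left (hr j) (weight_nonneg j)
    push_cast at h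
    omega
  | succ N ih =>
    intro r hr h
    have key : ∀ k, P.T < r k → ∀ γ ∈ Finset.Icc 1 P.I, ∃! μ, IsOutput P (topple r k γ) μ := by
      intro k hk γ hγ
      rw [Finset.mem_Icc] at hγ
      apply ih
      · intro j
        by_cases hj : j = k
        · subst hj
          simp only [topple, if_true]
          omega
        · exact (hr j).trans (le_topple_of_ne r hj (by omega))
      · rw [sum_weight_topple]
        push_cast at h
        omega
    by_cases hs : Stable P r
    · refine ⟨PMF.pure r, .stable hs, ?_⟩
      intro μ hμ
      cases hμ with
      | stable _ => rfl
      | topple k hk ν _ => exact absurd (hs k) (not_le.2 hk)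
    · obtain ⟨k, hk⟩ : ∃ k, P.T < r k := by
        simpa [Stable] using hs
      have out : ∀ k, P.T < r k → ∃ ν : ℤ → PMF (Config n),
          ∀ γ ∈ Finset.Icc 1 P.I, IsOutput P (topple r k γ) (ν γ) := by
        intro k hk
        refine ⟨fun γ => if hγ : γ ∈ Finset.Icc 1 P.I then (key k hk γ hγ).choose
          else PMF.pure r, fun γ hγ => ?_⟩
        simp only [dif_pos hγ]
        exact (key k hk γ hγ).choose_spec.1
      have bind_eq : ∀ ν ν' : ℤ → PMF (Config n), (∀ γ ∈ Finset.Icc 1 P.I, ν γ = ν' γ) →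
          (increment P).bind ν = (increment P).bind ν' := by
        intro ν ν' hν
        ext y
        simp only [PMF.bind_apply]
        refine tsum_congr fun γ => ?_
        by_cases hγ : γ ∈ Finset.Icc 1 P.I
        · rw [hν γ hγ]
        · have : increment P γ = 0 := by
            rw [increment, PMF.uniformOfFinset_apply_of_notMem _ hγ]
          simp [this]
      obtain ⟨ν, hν⟩ := out k hk
      refine ⟨(increment P).bind ν, .topple k hk ν hν, ?_⟩
      intro μ hμ
      cases hμ with
      | stable h' => exact absurd h' hs
      | topple l hl ν' hν' =>
        by_cases hkl : l = k
        · subst hkl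
          exact bind_eq _ _ fun γ hγ => (key l hl γ hγ).unique (hν' γ hγ) (hν γ hγ)
        · have hl' : ∀ γ ∈ Finset.Icc 1 P.I, P.T < topple r k γ l := fun γ hγ =>
            hl.trans_le (le_topple_of_ne r hkl (by rw [Finset.mem_Icc] at hγ; omega))
          have hk' : ∀ γ ∈ Finset.Icc 1 P.I, P.T < topple r l γ k := fun γ hγ =>
            hk.trans_le (le_topple_of_ne r (Ne.symm hkl) (by rw [Finset.mem_Icc] at hγ; omega))
          have two : ∀ γ ∈ Finset.Icc 1 P.I, ∀ γ' ∈ Finset.Icc 1 P.I,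
              ∃ μ, IsOutput P (topple (topple r k γ) l γ') μ := by
            intro γ hγ γ' hγ'
            obtain ⟨μ, hμ, -⟩ := key k hk γ hγ
            cases hμ with
            | stable h' => exact absurd (h' l) (not_le.2 (hl' γ hγ))
            | topple _ _ _ _ =>
              refine (ih _ ?_ ?_).exists
              · have hγ1 := Finset.mem_Icc.1 hγ
                have hγ2 := Finset.mem_Icc.1 hγ'
                have h1 : ∀ j, L ≤ topple r k γ j := by
                  intro j
                  by_cases hj : j = k
                  · subst hj
                    simp only [topple, if_true]
                    omega
                  · exact (hr j).trans (le_topple_of_ne r hj (by omega))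
                intro j
                by_cases hj : j = l
                · have := hl' γ hγ
                  rw [hj]
                  conv_rhs => rw [topple]
                  simp only [if_true]
                  omega
                · exact (h1 j).trans (le_topple_of_ne _ hj (by omega))
              · rw [sum_weight_topple, sum_weight_topple]
                have hγ1 := Finset.mem_Icc.1 hγ
                have hγ2 := Finset.mem_Icc.1 hγ'
                push_cast at h
                omega
          choose! m hm using two
          rw [bind_eq ν (fun γ => (increment P).bind (m γ)) fun γ hγ =>
              (key k hk γ hγ).unique (hν γ hγ) (.topple l (hl' γ hγ) _ (hm γ hγ)),
            bind_eq ν' (fun γ' => (increment P).bind fun γ => m γ γ') fun γ' hγ' =>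
              (key l hl γ' hγ').unique (hν' γ' hγ') (.topple k (hk' γ' hγ') _ fun γ hγ => by
                rw [← topple_comm]; exact hm γ hγ γ' hγ')]
          exact PMF.bind_comm _ _ _

end WellDefined

/-- The distribution of the output of the stochastic sandpile with input `r`. -/
noncomputable def stabilize (P : Params) (r : Config n) : PMF (Config n) :=
  (existsUnique_isOutput P r).choose

/-- `g ⊕ f`: the distribution of the stabilization of `r + s`, for independent `r ∼ g`, `s ∼ f`. -/
noncomputable def oplus (P : Params) (g f : PMF (Config n)) : PMF (Config n) :=
  g.bind fun r => f.bind fun s => stabilize P (r + s)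

/-- A finite distribution all of whose configurations are nonnegative. -/
def Nonneg (f : PMF (Config n)) : Prop :=
  f.support.Finite ∧ ∀ r ∈ f.support, ∀ k, 0 ≤ r k

/-- A finite combination `∑ p_i [r_i]` of at least two distinct configurations. -/
def IsMixed (g : PMF (Config n)) : Prop := g.support.Finite ∧ g.support.Nontrivial

def IsSteadyState (P : Params) (g : PMF (Config n)) : Prop :=
  ∀ f : PMF (Config n), Nonneg f → oplus P g f = g

/-- `log RHF (r) = (1 / n²) ∑_{i=1}^{n-1} (n - i) r_i`. -/
noncomputable def logRHF (r : Config n) : ℝ :=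
  1 / (n : ℝ) ^ 2 * ∑ i : Fin (n - 1), ((n : ℝ) - ((i.val : ℝ) + 1)) * (r i : ℝ)

noncomputable def RHF (r : Config n) : ℝ := Real.exp (logRHF r)

/-- The configurations of size `n` that the stochastic sandpile outputs with positive probability
for some input. -/
def outputs (P : Params) (n : ℕ) : Set (Config n) := {y | ∃ r, y ∈ (stabilize P r).support}

/-- The expectation of `F` under `g` (a finite sum if `g` has finite support). -/
noncomputable def mean (g : PMF (Config n)) (F : Config n → ℝ) : ℝ :=
  ∑' r, (g r).toReal * F r

end SSP

/-! Adding nonnegative configurations commutes with stabilization, so the operators `· ⊕ f` commute.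
One suitable `f₀` gives a Markov chain on the finite `window` in which every state leads in one step
to the constant configuration `T`, so its stationary distribution is unique. Every `· ⊕ f` preserves
this distribution, which is therefore a steady state. Two steady states absorb each other, hence
coincide. A steady state is not a point mass because toppling preserves `∑ (j + 1) r_j` modulo `n`.

The quantitative parts rest on `IsSteadyState.apply_le`: no configuration has steady-state
probability above `(2 / (I + 1)) ^ (n - 1)`. To reach `y` from `y + lap z`, the partial sums of the
increments at each vertex `k` must hit `z k`, and by order independence these events are bounded by
a product of renewal probabilities. Adding to the steady state a random configuration that shifts
each `z k` by an independent stationary delay changes nothing, and averages each factor to at most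
`2 / (I + 1)`, the inverse mean increment.

It remains to count: configurations with `logRHF` within `a` of the worst case satisfy `∑ (n - i) (T
- r_i) < a n²`, and for large `I` there are about `(a e²) ^ n` of them at most. Against `(2 / I) ^
n` this balances exactly at `a = I / (2 e²)`; the bounded height of the window tips the balance by
an exponential factor. For `I ≥ 2` and a small absolute `a` the same exponential Markov bound
decays. -/

/-! ### Stationary distributions of finite Markov chains -/

theorem PMF.bind_congr_support {α β : Type*} (p : PMF α) {f g : α → PMF β}
    (h : ∀ a ∈ p.support, f a = g a) : p.bind f = p.bind g := by
  ext y
  simp only [PMF.bind_apply]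
  refine tsum_congr fun a => ?_
  by_cases ha : p a = 0
  · simp [ha]
  · rw [h a ha]

theorem PMF.sum_toReal_eq_one {α : Type*} (p : PMF α) (X : Finset α) (h : ∀ x ∉ X, p x = 0) :
    ∑ x ∈ X, (p x).toReal = 1 := by
  rw [← ENNReal.toReal_sum fun x _ => p.apply_ne_top x,
    ← tsum_eq_sum (L := SummationFilter.unconditional α) h, p.tsum_coe, ENNReal.toReal_one]

theorem PMF.bind_apply_toReal {α β : Type*} (p : PMF α) (K : α → PMF β) (X : Finset α)
    (h : ∀ x ∉ X, p x = 0) (y : β) :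
    (p.bind K y).toReal = ∑ x ∈ X, (p x).toReal * (K x y).toReal := by
  rw [PMF.bind_apply, tsum_eq_sum (s := X) fun x hx => by simp [h x hx],
    ENNReal.toReal_sum fun x _ => ENNReal.mul_ne_top (p.apply_ne_top x) ((K x).apply_ne_top y)]
  simp

theorem PMF.ext_toReal {α : Type*} {p q : PMF α} (h : ∀ x, (p x).toReal = (q x).toReal) :
    p = q :=
  PMF.ext fun x => (ENNReal.toReal_eq_toReal_iff' (p.apply_ne_top x) (q.apply_ne_top x)).1 (h x)

/-- A Markov kernel with a finite absorbing set has a stationary distribution on that set. -/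
theorem PMF.exists_bind_eq_self {α : Type*} (K : α → PMF α) (X : Finset α) (hX : X.Nonempty)
    (hK : ∀ x ∈ X, ∀ y ∉ X, K x y = 0) :
    ∃ g : PMF α, (∀ x ∉ X, g x = 0) ∧ g.bind K = g := by
  classical
  set M : Matrix X X ℝ := fun x y => (K x y).toReal with hM
  have row : ∀ x : X, ∑ y : X, M x y = 1 := fun x => by
    rw [← (K x).sum_toReal_eq_one X (hK x x.2)]
    exact Finset.sum_coe_sort X fun y => (K x y).toReal
  -- Rows sum to one, so the all-ones vector is a right eigenvector for the eigenvalue 1; hence a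
  -- left eigenvector `v` exists too, possibly with mixed signs.
  have hdet : (M - 1).det = 0 := by
    refine Matrix.exists_mulVec_eq_zero_iff.1 ⟨fun _ => 1, ?_, ?_⟩
    · obtain ⟨x, hx⟩ := hX
      exact fun h => one_ne_zero (congrFun h ⟨x, hx⟩)
    · funext x
      rw [Matrix.sub_mulVec, Matrix.one_mulVec, Pi.sub_apply, Pi.zero_apply, sub_eq_zero]
      simpa only [Matrix.mulVec, dotProduct, mul_one] using row x
  obtain ⟨v, hv0, hv⟩ := Matrix.exists_vecMul_eq_zero_iff.2 hdet
  have hvM : ∀ y, ∑ x, v x * M x y = v y := fun y => by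
    have := congrFun hv y
    rw [Matrix.vecMul_sub, Matrix.vecMul_one] at this
    simpa [Matrix.vecMul, dotProduct, sub_eq_zero] using this
  have hle : ∀ y, |v y| ≤ ∑ x, |v x| * M x y := fun y => by
    rw [← hvM y]
    refine (Finset.abs_sum_le_sum_abs _ _).trans_eq (Finset.sum_congr rfl fun x _ => ?_)
    rw [abs_mul, abs_of_nonneg (show 0 ≤ M x y from ENNReal.toReal_nonneg)]
  have hsum : ∑ y, ∑ x, |v x| * M x y = ∑ x, |v x| := by
    rw [Finset.sum_comm]
    simp only [← Finset.mul_sum, row, mul_one]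
  -- The triangle inequality holds entrywise and both sides have the same total, so it is an
  -- equality everywhere: `|v|` is invariant as well.
  have heq : ∀ y, ∑ x, |v x| * M x y = |v y| := fun y =>
    ((Finset.sum_eq_sum_iff_of_le fun y _ => hle y).1 hsum.symm y (Finset.mem_univ y)).symm
  set W := ∑ x, |v x| with hW
  have hWpos : 0 < W := by
    obtain ⟨x, hx⟩ := Function.ne_iff.1 hv0
    exact Finset.sum_pos' (fun x _ => abs_nonneg _) ⟨x, Finset.mem_univ x, abs_pos.2 hx⟩
  set w : α → ℝ := fun x => if h : x ∈ X then |v ⟨x, h⟩| / W else 0 with hw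
  have hw0 : ∀ x, 0 ≤ w x := fun x => by
    simp only [hw]; split_ifs <;> positivity
  have hwX : ∀ x : X, w x = |v x| / W := fun x => by simp [hw]
  have hw1 : ∑ x ∈ X, w x = 1 := by
    rw [← Finset.sum_coe_sort, Finset.sum_congr rfl fun x _ => hwX x, ← Finset.sum_div]
    exact div_self hWpos.ne'
  set g : PMF α := PMF.ofFinset (fun x => ENNReal.ofReal (w x)) X
    (by rw [← ENNReal.ofReal_sum_of_nonneg fun x _ => hw0 x, hw1, ENNReal.ofReal_one])
    (fun x hx => by simp [hw, hx]) with hg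
  have hgw : ∀ x, (g x).toReal = w x := fun x => by
    rw [hg, PMF.ofFinset_apply, ENNReal.toReal_ofReal (hw0 x)]
  have hgX : ∀ x ∉ X, g x = 0 := fun x hx => by simp [hg, PMF.ofFinset_apply, hw, hx]
  refine ⟨g, hgX, PMF.ext_toReal fun y => ?_⟩
  rw [PMF.bind_apply_toReal g K X hgX]
  simp only [hgw]
  by_cases hy : y ∈ X
  · rw [← Finset.sum_coe_sort, show w y = |v ⟨y, hy⟩| / W from hwX ⟨y, hy⟩, ← heq, Finset.sum_div]
    refine Finset.sum_congr rfl fun x _ => ?_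
    rw [hwX, div_mul_eq_mul_div]
  · rw [Finset.sum_eq_zero fun x hx => by rw [hK x hx y hy]; simp]
    simp [hw, hy]

/-- If every state of the finite set `X` leads to the state `t`, then there is at most one
stationary distribution on `X`. -/
theorem PMF.eq_of_bind_eq_self {α : Type*} (K : α → PMF α) (X : Finset α)
    (hK : ∀ x ∈ X, ∀ y ∉ X, K x y = 0) (t : α) (ht : ∀ x ∈ X, K x t ≠ 0) {g g' : PMF α}
    (hg : ∀ x ∉ X, g x = 0) (hg' : ∀ x ∉ X, g' x = 0) (h : g.bind K = g) (h' : g'.bind K = g') :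
    g = g' := by
  -- The signed measure `v` is invariant with total mass zero. Equality in the triangle inequality
  -- at `t`, where all weights `K x t` are positive, forces `v` to have a constant sign, hence to
  -- vanish.
  set v : α → ℝ := fun x => (g x).toReal - (g' x).toReal with hv
  have hfix : ∀ y, ∑ x ∈ X, v x * (K x y).toReal = v y := fun y => by
    simp only [hv, sub_mul, Finset.sum_sub_distrib]
    rw [← PMF.bind_apply_toReal g K X hg, ← PMF.bind_apply_toReal g' K X hg', h, h']
  have hsum0 : ∑ x ∈ X, v x = 0 := by
    simp only [hv, Finset.sum_sub_distrib]
    rw [g.sum_toReal_eq_one X hg, g'.sum_toReal_eq_one X hg', sub_self]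
  have hle : ∀ y, |v y| ≤ ∑ x ∈ X, |v x| * (K x y).toReal := fun y => by
    rw [← hfix y]
    refine (Finset.abs_sum_le_sum_abs _ _).trans_eq (Finset.sum_congr rfl fun x _ => ?_)
    rw [abs_mul, abs_of_nonneg (ENNReal.toReal_nonneg (a := K x y))]
  have hsum : ∑ y ∈ X, ∑ x ∈ X, |v x| * (K x y).toReal = ∑ x ∈ X, |v x| := by
    rw [Finset.sum_comm]
    refine Finset.sum_congr rfl fun x hx => ?_
    rw [← Finset.mul_sum, (K x).sum_toReal_eq_one X (hK x hx), mul_one]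
  have hpos : ∀ x ∈ X, 0 < (K x t).toReal := fun x hx =>
    ENNReal.toReal_pos (ht x hx) ((K x).apply_ne_top t)
  have hv0 : ∀ x ∈ X, v x = 0 := by
    rcases X.eq_empty_or_nonempty with rfl | ⟨x₀, hx₀⟩
    · simp
    have htX : t ∈ X := by
      by_contra htX
      exact ht x₀ hx₀ (hK x₀ hx₀ t htX)
    have heq : ∑ x ∈ X, |v x| * (K x t).toReal = |v t| :=
      ((Finset.sum_eq_sum_iff_of_le fun y _ => hle y).1 hsum.symm t htX).symm
    have zero : ∀ u : α → ℝ, (∀ x, 0 ≤ u x) → ∑ x ∈ X, u x * (K x t).toReal = 0 →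
        ∀ x ∈ X, u x = 0 := fun u hu hu0 x hx => by
      have := (Finset.sum_eq_zero_iff_of_nonneg
        fun x hx => mul_nonneg (hu x) (hpos x hx).le).1 hu0 x hx
      exact (mul_eq_zero.1 this).resolve_right (hpos x hx).ne'
    have same : (∀ x ∈ X, 0 ≤ v x) ∨ ∀ x ∈ X, v x ≤ 0 := by
      rcases le_total 0 (v t) with hvt | hvt
      · left
        rw [abs_of_nonneg hvt, ← hfix t] at heq
        intro x hx
        have := zero (fun x => |v x| - v x) (fun x => sub_nonneg.2 (le_abs_self _)) (by
          simp only [sub_mul, Finset.sum_sub_distrib, heq, sub_self]) x hx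
        have h0 := abs_nonneg (v x)
        linarith
      · right
        rw [abs_of_nonpos hvt, ← hfix t] at heq
        intro x hx
        have := zero (fun x => |v x| + v x) (fun x => by linarith [neg_abs_le (v x)]) (by
          simp only [add_mul, Finset.sum_add_distrib, heq, neg_add_cancel]) x hx
        have h0 := abs_nonneg (v x)
        linarith
    rcases same with hs | hs
    · exact (Finset.sum_eq_zero_iff_of_nonneg hs).1 hsum0
    · exact (Finset.sum_eq_zero_iff_of_nonpos hs).1 hsum0
  refine PMF.ext_toReal fun x => ?_
  by_cases hx : x ∈ X
  · exact sub_eq_zero.1 (hv0 x hx)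
  · rw [hg x hx, hg' x hx]

/-! ### Existence and uniqueness of the steady state -/

namespace SSP

variable {n : ℕ}

theorem isOutput_stabilize (P : Params) (r : Config n) : IsOutput P r (stabilize P r) :=
  (existsUnique_isOutput P r).choose_spec.1

theorem IsOutput.stabilize_eq {P : Params} {r : Config n} {μ : PMF (Config n)}
    (h : IsOutput P r μ) : stabilize P r = μ :=
  (existsUnique_isOutput P r).unique (isOutput_stabilize P r) h

theorem stabilize_of_stable {P : Params} {r : Config n} (h : Stable P r) :
    stabilize P r = PMF.pure r :=
  (IsOutput.stable h).stabilize_eq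

theorem mem_support_increment (P : Params) (γ : ℤ) :
    γ ∈ (increment P).support ↔ γ ∈ Finset.Icc 1 P.I :=
  PMF.mem_support_uniformOfFinset_iff _ _

/-- The configurations whose heights lie within `2I` of the threshold. -/
noncomputable def window (P : Params) (n : ℕ) : Finset (Config n) :=
  Fintype.piFinset fun _ => Finset.Ioc (P.T - 2 * P.I) P.T

theorem mem_window {P : Params} {r : Config n} :
    r ∈ window P n ↔ ∀ k, P.T - 2 * P.I < r k ∧ r k ≤ P.T := by
  simp [window]

/-- A toppled vertex starts above `T` and loses at most `2I`, and the other vertices never lose, so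
the lower bound `T - 2I` persists. -/
theorem IsOutput.mem_window {P : Params} {r : Config n} {μ : PMF (Config n)}
    (h : IsOutput P r μ) (hr : ∀ k, P.T - 2 * P.I < r k) : ∀ y ∈ μ.support, y ∈ window P n := by
  induction h with
  | stable hs =>
    intro y hy
    rw [PMF.support_pure, Set.mem_singleton_iff] at hy
    rw [hy]
    exact SSP.mem_window.2 fun k => ⟨hr k, hs k⟩
  | @topple r k hk ν _ ih =>
    intro y hy
    obtain ⟨γ, hγ, hy⟩ := (PMF.mem_support_bind_iff _ _ _).1 hy
    rw [mem_support_increment] at hγ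
    refine ih γ hγ (fun j => ?_) y hy
    have hγ' := Finset.mem_Icc.1 hγ
    by_cases hj : j = k
    · subst hj
      simp only [SSP.topple, if_true]
      omega
    · exact (hr j).trans_le (le_topple_of_ne r hj (by omega))

theorem IsOutput.stable_of_mem_support {P : Params} {r : Config n} {μ : PMF (Config n)}
    (h : IsOutput P r μ) : ∀ y ∈ μ.support, Stable P y := by
  induction h with
  | stable hs =>
    intro y hy
    rw [PMF.support_pure, Set.mem_singleton_iff] at hy
    rwa [hy]
  | topple k hk ν _ ih =>
    intro y hy
    obtain ⟨γ, hγ, hy⟩ := (PMF.mem_support_bind_iff _ _ _).1 hy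
    exact ih γ ((mem_support_increment P γ).1 hγ) y hy

theorem stabilize_apply_eq_zero {P : Params} {r : Config n} (hr : ∀ k, P.T - 2 * P.I < r k)
    {y : Config n} (hy : y ∉ window P n) : stabilize P r y = 0 := by
  by_contra h
  exact hy ((isOutput_stabilize P r).mem_window hr y h)

theorem topple_add (r s : Config n) (k : Fin (n - 1)) (γ : ℤ) :
    topple (r + s) k γ = topple r k γ + s := by
  funext j
  simp only [topple_eq, Pi.add_apply]
  ring

/-- Adding a nonnegative configuration before or after the stabilization amounts to the same. -/
theorem stabilize_add (P : Params) (r s : Config n) (hs : ∀ k, 0 ≤ s k) :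
    stabilize P (r + s) = (stabilize P r).bind fun y => stabilize P (y + s) := by
  -- As `s ≥ 0`, a vertex unstable in `r` is unstable in `r + s`, so a run from `r` is also the
  -- beginning of a legal run from `r + s`. Order independence does the rest.
  suffices H : ∀ (r : Config n) (μ : PMF (Config n)), IsOutput P r μ →
      IsOutput P (r + s) (μ.bind fun y => stabilize P (y + s)) from
    (H r _ (isOutput_stabilize P r)).stabilize_eq
  intro r μ h
  induction h with
  | stable _ =>
    rw [PMF.pure_bind]
    exact isOutput_stabilize P _
  | @topple r k hk ν _ ih =>
    rw [PMF.bind_bind]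
    refine .topple k ?_ _ fun γ hγ => ?_
    · have := hs k
      simp only [Pi.add_apply]
      omega
    · rw [topple_add]
      exact ih γ hγ

theorem oplus_oplus (P : Params) (g f h : PMF (Config n)) (hh : Nonneg h) :
    oplus P (oplus P g f) h
      = g.bind fun r => f.bind fun s => h.bind fun t => stabilize P (r + s + t) := by
  unfold oplus
  simp only [PMF.bind_bind]
  congr 1; funext r
  congr 1; funext s
  rw [PMF.bind_comm]
  exact PMF.bind_congr_support _ fun t ht => (stabilize_add P (r + s) t (hh.2 t ht)).symm

theorem oplus_right_comm (P : Params) (g f h : PMF (Config n)) (hf : Nonneg f) (hh : Nonneg h) :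
    oplus P (oplus P g f) h = oplus P (oplus P g h) f := by
  rw [oplus_oplus P g f h hh, oplus_oplus P g h f hf]
  congr 1; funext r
  rw [PMF.bind_comm]
  simp only [add_right_comm r]

theorem nonneg_pure {s : Config n} (hs : ∀ k, 0 ≤ s k) : Nonneg (PMF.pure s) := by
  constructor
  · rw [PMF.support_pure]; exact Set.finite_singleton s
  · intro r hr
    rw [PMF.support_pure, Set.mem_singleton_iff] at hr
    rwa [hr]

theorem window_nonneg {P : Params} {r : Config n} (hr : r ∈ window P n) (k : Fin (n - 1)) :
    0 ≤ r k := by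
  have h1 := (mem_window.1 hr k).1
  have h2 := P.two_mul_I_le
  omega

theorem oplus_apply_eq_zero {P : Params} {g f : PMF (Config n)}
    (hg : ∀ x ∉ window P n, g x = 0) (hf : Nonneg f) {y : Config n} (hy : y ∉ window P n) :
    oplus P g f y = 0 := by
  by_contra h
  obtain ⟨r, hr, h⟩ := (PMF.mem_support_bind_iff _ _ _).1 h
  obtain ⟨s, hs, h⟩ := (PMF.mem_support_bind_iff _ _ _).1 h
  refine h (stabilize_apply_eq_zero (fun k => ?_) hy)
  have h1 := (mem_window.1 (not_imp_comm.1 (hg r) hr) k).1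
  have h2 := hf.2 s hs k
  simp only [Pi.add_apply]
  omega

/-- Finite support is not part of the definition of a steady state. All but arbitrarily little mass
sits on a finite set `F`; adding a large constant `m` lifts `F` above the lower edge of the window,
so the mass at `x` outside the window can only come from outside `F`. -/
theorem IsSteadyState.apply_eq_zero {P : Params} {g : PMF (Config n)} (hg : IsSteadyState P g)
    {x : Config n} (hx : x ∉ window P n) : g x = 0 := by
  by_contra hgx
  have hlim := ENNReal.tendsto_tsum_compl_atTop_zero (f := g) (by simp)
  obtain ⟨F, hF⟩ := (hlim.eventually (gt_mem_nhds (pos_iff_ne_zero.2 hgx))).exists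
  obtain ⟨m, hm0, hm⟩ : ∃ m : ℤ, 0 ≤ m ∧ ∀ r ∈ F, ∀ k, P.T - 2 * P.I < r k + m := by
    refine ⟨P.T + ∑ r ∈ F, ∑ k, |r k|, ?_, fun r hr k => ?_⟩
    · have : 0 ≤ ∑ r ∈ F, ∑ k, |r k| :=
        Finset.sum_nonneg fun _ _ => Finset.sum_nonneg fun _ _ => abs_nonneg _
      have := P.I_pos
      have := P.two_mul_I_le
      omega
    · have h1 : ∑ k, |r k| ≤ ∑ r ∈ F, ∑ k, |r k| :=
        Finset.single_le_sum (f := fun r : Config n => ∑ k, |r k|)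
          (fun _ _ => Finset.sum_nonneg fun _ _ => abs_nonneg _) hr
      have h2 : |r k| ≤ ∑ k, |r k| :=
        Finset.single_le_sum (f := fun k => |r k|) (fun _ _ => abs_nonneg _) (Finset.mem_univ k)
      have h3 := neg_abs_le (r k)
      have := P.I_pos
      omega
  have hfix := hg _ (nonneg_pure (s := fun _ => m) fun _ => hm0)
  have hle : g x ≤ ∑' r : {r // r ∉ F}, g r := by
    conv_lhs => rw [← hfix]
    simp only [oplus, PMF.pure_bind, PMF.bind_apply]
    rw [← tsum_subtype_eq_of_support_subset (s := {r | r ∉ F})]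
    · refine ENNReal.tsum_le_tsum fun r => ?_
      exact mul_le_of_le_one_right' (PMF.coe_le_one _ _)
    · intro r hr hrF
      refine hr ?_
      beta_reduce
      rw [stabilize_apply_eq_zero (r := r + fun _ => m) (hm r hrF) hx, mul_zero]
  exact absurd hle (not_le.2 hF)

theorem IsSteadyState.support_subset {P : Params} {g : PMF (Config n)} (hg : IsSteadyState P g) :
    g.support ⊆ window P n := fun _ hx => by
  by_contra h
  exact hx (hg.apply_eq_zero h)

theorem IsSteadyState.nonneg {P : Params} {g : PMF (Config n)} (hg : IsSteadyState P g) :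
    Nonneg g :=
  ⟨(window P n).finite_toSet.subset hg.support_subset,
    fun _ hr k => window_nonneg (hg.support_subset hr) k⟩

theorem oplus_comm (P : Params) (g f : PMF (Config n)) : oplus P g f = oplus P f g := by
  unfold oplus
  rw [PMF.bind_comm]
  simp only [add_comm]

/-- Steady states live on the window, which is nonnegative because `2I ≤ T`, so each may be added to
the other. -/
theorem IsSteadyState.eq {P : Params} {g g' : PMF (Config n)} (hg : IsSteadyState P g)
    (hg' : IsSteadyState P g') : g = g' := by
  rw [← hg g' hg'.nonneg, oplus_comm, hg' g hg.nonneg]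

theorem exists_isSteadyState (P : Params) (n : ℕ) : ∃ g : PMF (Config n), IsSteadyState P g := by
  classical
  have hT := P.two_mul_I_le
  have hI := P.I_pos
  set t : Config n := fun _ => P.T with ht
  have htX : t ∈ window P n := mem_window.2 fun k => ⟨by simp only [ht]; omega, le_rfl⟩
  have hne : ((window P n).image fun x => t - x).Nonempty := ⟨_, Finset.mem_image_of_mem _ htX⟩
  -- From any `x` in the window, the summand `t - x` leads straight to the stable configuration `t`,
  -- as the uniqueness criterion requires.
  set f₀ : PMF (Config n) := PMF.uniformOfFinset _ hne with hf₀
  have hf₀n : Nonneg f₀ := by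
    constructor
    · rw [hf₀, PMF.support_uniformOfFinset]
      exact Finset.finite_toSet _
    · intro s hs k
      rw [hf₀, PMF.mem_support_uniformOfFinset_iff, Finset.mem_image] at hs
      obtain ⟨x, hx, rfl⟩ := hs
      exact sub_nonneg.2 (mem_window.1 hx k).2
  set K : Config n → PMF (Config n) := fun r => f₀.bind fun s => stabilize P (r + s) with hKdef
  have hK : ∀ x ∈ window P n, ∀ y ∉ window P n, K x y = 0 := fun x hx y hy => by
    have := oplus_apply_eq_zero (P := P) (g := PMF.pure x) (fun z hz => by
      rw [PMF.pure_apply, if_neg]; rintro rfl; exact hz hx) hf₀n hy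
    rwa [oplus, PMF.pure_bind] at this
  have hKt : ∀ x ∈ window P n, K x t ≠ 0 := fun x hx => by
    rw [← PMF.mem_support_iff, hKdef, PMF.mem_support_bind_iff]
    refine ⟨t - x, ?_, ?_⟩
    · rw [hf₀, PMF.mem_support_uniformOfFinset_iff]
      exact Finset.mem_image_of_mem _ hx
    · rw [add_sub_cancel, stabilize_of_stable fun k => (mem_window.1 htX k).2]
      simp
  obtain ⟨g, hgX, hg⟩ := PMF.exists_bind_eq_self K (window P n) ⟨t, htX⟩ hK
  refine ⟨g, fun f hf => ?_⟩
  -- `g ⊕ f` is again stationary for `K`, because adding `f` commutes with adding `f₀`.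
  refine PMF.eq_of_bind_eq_self K (window P n) hK t hKt
    (fun x hx => oplus_apply_eq_zero hgX hf hx) hgX ?_ hg
  have := oplus_right_comm P g f f₀ hf hf₀n
  rw [show oplus P g f₀ = g from hg] at this
  exact this

end SSP

/-! ### Renewal probabilities for uniform increments -/

/-- The probability that a random walk from `0` whose steps are uniform on `{1, …, I}`
visits `s`. -/
noncomputable def uniformRenewal (I : ℕ) (s : ℕ) : ℝ :=
  if s = 0 then 1 else ∑ j : Fin s, if s - j.val ≤ I then uniformRenewal I j.val / I else 0
termination_by s
decreasing_by exact j.isLt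

theorem uniformRenewal_zero (I : ℕ) : uniformRenewal I 0 = 1 := by
  rw [uniformRenewal]; simp

theorem uniformRenewal_succ (I s : ℕ) : uniformRenewal I (s + 1)
    = ∑ j ∈ Finset.range (s + 1), if s + 1 - j ≤ I then uniformRenewal I j / I else 0 := by
  rw [uniformRenewal, if_neg s.succ_ne_zero,
    Fin.sum_univ_eq_sum_range fun j => if s + 1 - j ≤ I then uniformRenewal I j / (I : ℝ) else 0]

theorem uniformRenewal_nonneg (I s : ℕ) : 0 ≤ uniformRenewal I s := by
  induction s using Nat.strong_induction_on with
  | _ s ih =>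
    cases s with
    | zero => rw [uniformRenewal_zero]; exact zero_le_one
    | succ s =>
      rw [uniformRenewal_succ]
      refine Finset.sum_nonneg fun j hj => ?_
      split_ifs
      · exact div_nonneg (ih j (Finset.mem_range.1 hj)) (Nat.cast_nonneg I)
      · exact le_rfl

/-- The renewals before time `c`, weighted with the probability that the next step leads
beyond `c`, add up to one. -/
theorem sum_uniformRenewal_mul (I : ℕ) (hI : 0 < I) (c : ℕ) :
    ∑ j ∈ Finset.range (c + 1), uniformRenewal I j * (((I - (c - j) : ℕ) : ℝ) / I) = 1 := by
  have hI' : (I : ℝ) ≠ 0 := by positivity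
  induction c with
  | zero => simp [uniformRenewal_zero, hI']
  | succ c ih =>
    -- From `c` to `c + 1` each earlier `j` with `c + 1 - j ≤ I` loses `uniformRenewal I j / I`; by
    -- the recursion these losses add up to the new term at `c + 1`.
    rw [Finset.sum_range_succ, Nat.sub_self, Nat.sub_zero, div_self hI', mul_one,
      uniformRenewal_succ, ← Finset.sum_add_distrib, ← ih]
    refine Finset.sum_congr rfl fun j hj => ?_
    have hj' := Finset.mem_range.1 hj
    split_ifs with h
    · have : I - (c - j) = I - (c + 1 - j) + 1 := by omega
      rw [this]
      push_cast
      ring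
    · have h1 : I - (c - j) = 0 := by omega
      have h2 : I - (c + 1 - j) = 0 := by omega
      simp [h1, h2]

/-- `uniformRenewal`, extended to the integers by zero. -/
noncomputable def uniformRenewalInt (I : ℕ) (s : ℤ) : ℝ :=
  if 0 ≤ s then uniformRenewal I s.toNat else 0

theorem uniformRenewalInt_nonneg (I : ℕ) (s : ℤ) : 0 ≤ uniformRenewalInt I s := by
  unfold uniformRenewalInt
  split_ifs
  · exact uniformRenewal_nonneg _ _
  · exact le_rfl

theorem uniformRenewalInt_zero (I : ℕ) : uniformRenewalInt I 0 = 1 := by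
  simp [uniformRenewalInt, uniformRenewal_zero]

/-- The renewal recursion, indexed by the step `γ`. It is strict only at `s = 0`, where the walk
starts without a step. -/
theorem sum_uniformRenewalInt_sub_le (I : ℕ) (s : ℤ) :
    ∑ γ ∈ Finset.Icc (1 : ℤ) I, uniformRenewalInt I (s - γ) / I ≤ uniformRenewalInt I s := by
  rcases le_or_gt s 0 with hs | hs
  · rw [Finset.sum_eq_zero]
    · exact uniformRenewalInt_nonneg I s
    · intro γ hγ
      have := Finset.mem_Icc.1 hγ
      rw [uniformRenewalInt, if_neg (by omega), zero_div]
  · obtain ⟨c, rfl⟩ : ∃ c : ℕ, s = (c + 1 : ℕ) := ⟨(s - 1).toNat, by omega⟩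
    apply le_of_eq
    conv_rhs => rw [uniformRenewalInt, if_pos hs.le, Int.toNat_natCast, uniformRenewal_succ]
    rw [← Finset.sum_filter,
      ← Finset.sum_filter_add_sum_filter_not (Finset.Icc (1 : ℤ) I) fun γ : ℤ => γ ≤ (c + 1 : ℕ)]
    rw [Finset.sum_eq_zero (s := (Finset.Icc (1 : ℤ) I).filter fun γ : ℤ => ¬ γ ≤ (c + 1 : ℕ)),
      add_zero]
    · refine Finset.sum_bij' (fun γ _ => (((c + 1 : ℕ) : ℤ) - γ).toNat)
        (fun j _ => ((c + 1 : ℕ) : ℤ) - j) ?_ ?_ ?_ ?_ ?_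
      · intro γ hγ
        simp only [Finset.mem_filter, Finset.mem_Icc, Finset.mem_range] at hγ ⊢
        omega
      · intro j hj
        simp only [Finset.mem_filter, Finset.mem_Icc, Finset.mem_range] at hj ⊢
        omega
      · intro γ hγ
        simp only [Finset.mem_filter, Finset.mem_Icc] at hγ
        omega
      · intro j hj
        simp only [Finset.mem_filter, Finset.mem_range] at hj
        omega
      · intro γ hγ
        simp only [Finset.mem_filter, Finset.mem_Icc] at hγ
        rw [uniformRenewalInt, if_pos (by omega)]
    · intro γ hγ
      simp only [Finset.mem_filter, Finset.mem_Icc] at hγ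
      rw [uniformRenewalInt, if_neg (by omega), zero_div]

/-- The stationary delay of the renewal process with steps uniform on `{1, …, I}`. -/
noncomputable def stationaryDelay (I : ℕ) (v : ℕ) : ℝ :=
  2 * ((I - v : ℕ) : ℝ) / (I * (I + 1))

theorem stationaryDelay_nonneg (I v : ℕ) : 0 ≤ stationaryDelay I v := by
  unfold stationaryDelay; positivity

theorem sum_stationaryDelay (I : ℕ) (hI : 0 < I) :
    ∑ v ∈ Finset.range I, stationaryDelay I v = 1 := by
  have h : ∀ m : ℕ, 2 * ∑ v ∈ Finset.range m, ((m - v : ℕ) : ℝ) = m * (m + 1) := fun m => by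
    induction m with
    | zero => simp
    | succ m ih =>
      rw [Finset.sum_range_succ', mul_add]
      simp only [Nat.add_sub_add_right, Nat.sub_zero]
      rw [ih]
      push_cast
      ring
  unfold stationaryDelay
  rw [← Finset.sum_div, ← Finset.mul_sum, h, div_self (by positivity)]

/-- The delay at `v` is `2 / (I + 1)` times the probability `(I - v) / I` that a step exceeds `v`.
With `j = c - v` the sum becomes that of `sum_uniformRenewal_mul`. -/
theorem sum_stationaryDelay_mul_le (I : ℕ) (hI : 0 < I) (c : ℤ) :
    ∑ v ∈ Finset.range I, stationaryDelay I v * uniformRenewalInt I (c - v) ≤ 2 / (I + 1) := by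
  rcases lt_or_ge c 0 with hc | hc
  · rw [Finset.sum_eq_zero]
    · positivity
    · intro v _
      rw [uniformRenewalInt, if_neg (by omega), mul_zero]
  · lift c to ℕ using hc
    have key := sum_uniformRenewal_mul I hI c
    rw [← Finset.sum_range_reflect] at key
    have e : ∑ v ∈ Finset.range I, stationaryDelay I v * uniformRenewalInt I (c - v)
        = ∑ v ∈ (Finset.range I).filter (· ≤ c),
          stationaryDelay I v * uniformRenewal I (c - v) := by
      rw [Finset.sum_filter]
      refine Finset.sum_congr rfl fun v _ => ?_
      unfold uniformRenewalInt
      split_ifs with h1 h2 h2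
      · rw [show ((c : ℤ) - v).toNat = c - v by omega]
      · omega
      · omega
      · rw [mul_zero]
    have key' := congrArg (2 / ((I : ℝ) + 1) * ·) key
    simp only [mul_one, Finset.mul_sum] at key'
    rw [e, ← key']
    refine (Finset.sum_le_sum_of_subset_of_nonneg (t := Finset.range (c + 1)) ?_ ?_).trans_eq ?_
    · intro v
      simp only [Finset.mem_filter, Finset.mem_range]
      omega
    · intro v _ _
      exact mul_nonneg (stationaryDelay_nonneg _ _) (uniformRenewal_nonneg _ _)
    · refine Finset.sum_congr rfl fun v hv => ?_
      have hv' := Finset.mem_range.1 hv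
      rw [show c + 1 - 1 - v = c - v by omega, show c - (c - v) = v by omega, stationaryDelay]
      field_simp

/-! ### The Dirichlet Laplacian and the probability of a single configuration -/

namespace SSP

variable {n : ℕ}

/-- A vector indexed by the non-sink vertices, extended by zero to all of `ℕ`. -/
def extend (z : Fin (n - 1) → ℤ) (i : ℕ) : ℤ :=
  if h : 0 < i ∧ i - 1 < n - 1 then z ⟨i - 1, h.2⟩ else 0

/-- The Laplacian of the path with Dirichlet boundary conditions. -/
def lap (z : Fin (n - 1) → ℤ) : Config n := fun j =>
  2 * extend z (j + 1) - extend z j - extend z (j + 2)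

theorem extend_succ (z : Fin (n - 1) → ℤ) (j : Fin (n - 1)) : extend z (j.val + 1) = z j := by
  simp [extend]

theorem extend_add (z w : Fin (n - 1) → ℤ) (i : ℕ) :
    extend (z + w) i = extend z i + extend w i := by
  unfold extend; split_ifs <;> simp

theorem extend_neg (z : Fin (n - 1) → ℤ) (i : ℕ) : extend (-z) i = -extend z i := by
  unfold extend; split_ifs <;> simp

theorem extend_nonneg {z : Fin (n - 1) → ℤ} (hz : ∀ k, 0 ≤ z k) (i : ℕ) : 0 ≤ extend z i := by
  unfold extend
  split_ifs
  · exact hz _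
  · exact le_rfl

theorem lap_add (z w : Fin (n - 1) → ℤ) : lap (z + w) = lap z + lap w := by
  funext j
  simp only [lap, extend_add, Pi.add_apply]
  ring

theorem lap_neg (z : Fin (n - 1) → ℤ) : lap (-z) = -lap z := by
  funext j
  simp only [lap, extend_neg, Pi.neg_apply]
  ring

theorem topple_eq_sub_lap (r : Config n) (k : Fin (n - 1)) (γ : ℤ) :
    topple r k γ = r - lap (Pi.single k γ) := by
  funext j
  have hj := j.isLt
  have hk := k.isLt
  have e : ∀ i : ℕ, extend (Pi.single k γ) i = if i = k.val + 1 then γ else 0 := fun i => by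
    unfold extend
    by_cases h : 0 < i ∧ i - 1 < n - 1
    · rw [dif_pos h, Pi.single_apply]
      refine if_congr ?_ rfl rfl
      rw [Fin.ext_iff]
      change i - 1 = k.val ↔ _
      omega
    · rw [dif_neg h, if_neg (by omega)]
  rw [topple_eq, Pi.sub_apply, lap, e, e, e]
  simp only [Fin.ext_iff]
  split_ifs <;> omega

/-- Summation by parts against the linear, hence harmonic, function `j + 1`: only boundary terms
survive. -/
theorem sum_mul_lap (z : ℕ → ℤ) (m : ℕ) :
    ∑ j ∈ Finset.range m, ((j : ℤ) + 1) * (2 * z (j + 1) - z j - z (j + 2))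
      = (m + 1) * z m - m * z (m + 1) - z 0 := by
  induction m with
  | zero => simp
  | succ m ih =>
    rw [Finset.sum_range_succ, ih]
    push_cast
    ring

theorem extend_zero (z : Fin (n - 1) → ℤ) : extend z 0 = 0 := by simp [extend]

theorem extend_of_le (z : Fin (n - 1) → ℤ) {i : ℕ} (h : n - 1 < i) : extend z i = 0 := by
  rw [extend, dif_neg (by omega)]

/-- The only surviving boundary term is `n * extend z (n - 1)`. This yields an invariant of toppling
modulo `n`. -/
theorem dvd_sum_mul_lap (z : Fin (n - 1) → ℤ) (hn : 0 < n) :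
    (n : ℤ) ∣ ∑ j : Fin (n - 1), ((j.val : ℤ) + 1) * lap z j := by
  have := sum_mul_lap (extend z) (n - 1)
  rw [extend_of_le z (by omega : n - 1 < n - 1 + 1), extend_zero, mul_zero, sub_zero,
    sub_zero] at this
  unfold lap
  rw [Fin.sum_univ_eq_sum_range
    fun j : ℕ => ((j : ℤ) + 1) * (2 * extend z (j + 1) - extend z j - extend z (j + 2)), this]
  refine ⟨extend z (n - 1), ?_⟩
  congr 1
  omega

theorem eq_zero_of_lap_eq_zero {z : Fin (n - 1) → ℤ} (h : lap z = 0) : z = 0 := by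
  have step : ∀ m ≤ n - 1, ((m : ℤ) + 1) * extend z m = m * extend z (m + 1) := fun m hm => by
    have := sum_mul_lap (extend z) m
    rw [Finset.sum_eq_zero, extend_zero] at this
    · linarith
    · intro j hj
      have hj' : j < n - 1 := (Finset.mem_range.1 hj).trans_le hm
      have := congrFun h ⟨j, hj'⟩
      simp only [lap, Pi.zero_apply] at this
      rw [this, mul_zero]
  -- Descend from the boundary value zero at `m = n`, using `step`.
  have desc : ∀ d, ∀ m, m + d = n → extend z m = 0 := fun d => by
    induction d with
    | zero =>
      intro m hm
      rcases Nat.eq_zero_or_pos m with rfl | hm0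
      · exact extend_zero z
      · exact extend_of_le z (by omega)
    | succ d ih =>
      intro m hm
      have := step m (by omega)
      rw [ih (m + 1) (by omega), mul_zero] at this
      exact (mul_eq_zero.1 this).resolve_left (by positivity)
  funext k
  have hk := k.isLt
  rw [← extend_succ z k]
  exact desc (n - (k.val + 1)) _ (by omega)

theorem increment_bind_apply_toReal (P : Params) (ν : ℤ → PMF (Config n)) (y : Config n) :
    ((increment P).bind ν y).toReal
      = ∑ γ ∈ Finset.Icc 1 P.I, (ν γ y).toReal / (P.I.toNat : ℝ) := by
  rw [PMF.bind_apply_toReal _ _ (Finset.Icc 1 P.I) fun γ hγ => by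
    rw [increment, PMF.uniformOfFinset_apply_of_notMem _ hγ]]
  refine Finset.sum_congr rfl fun γ hγ => ?_
  rw [increment, PMF.uniformOfFinset_apply_of_mem _ hγ, ENNReal.toReal_inv,
    ENNReal.toReal_natCast, Int.card_Icc, add_sub_cancel_right, inv_mul_eq_div]

/-- Here `z k` is the total amount toppled at `k` along a run ending in `y`. -/
theorem IsOutput.exists_eq_add_lap {P : Params} {r : Config n} {μ : PMF (Config n)}
    (h : IsOutput P r μ) : ∀ y ∈ μ.support, ∃ z, r = y + lap z := by
  induction h with
  | stable _ =>
    intro y hy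
    rw [PMF.support_pure, Set.mem_singleton_iff] at hy
    refine ⟨-0, ?_⟩
    rw [hy, lap_neg, eq_comm, add_eq_left, neg_eq_zero]
    funext j
    simp [lap, extend]
  | @topple r k hk ν _ ih =>
    intro y hy
    obtain ⟨γ, hγ, hy⟩ := (PMF.mem_support_bind_iff _ _ _).1 hy
    obtain ⟨z, hz⟩ := ih γ ((mem_support_increment P γ).1 hγ) y hy
    refine ⟨z + Pi.single k γ, ?_⟩
    rw [lap_add, ← add_assoc, ← hz, topple_eq_sub_lap, sub_add_cancel]

/-- To go from `y + lap z` to `y`, the amounts toppled at every vertex `k` have to add up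
to `z k`. -/
theorem IsOutput.apply_le_prod {P : Params} {r : Config n} {μ : PMF (Config n)}
    (h : IsOutput P r μ) : ∀ y z, r = y + lap z →
      (μ y).toReal ≤ ∏ k, uniformRenewalInt P.I.toNat (z k) := by
  have hI := P.I_pos
  have prod_nonneg : ∀ (s : Finset (Fin (n - 1))) (z : Fin (n - 1) → ℤ),
      0 ≤ ∏ k ∈ s, uniformRenewalInt P.I.toNat (z k) :=
    fun s z => Finset.prod_nonneg fun _ _ => uniformRenewalInt_nonneg _ _
  induction h with
  | @stable r _ =>
    intro y z hr
    by_cases hy : y = r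
    · subst hy
      have : z = 0 := eq_zero_of_lap_eq_zero (left_eq_add.1 hr)
      simp [this, uniformRenewalInt_zero]
    · rw [PMF.pure_apply, if_neg hy]
      exact prod_nonneg _ z
  | @topple r k hk ν _ ih =>
    intro y z hr
    rw [increment_bind_apply_toReal, ← Finset.mul_prod_erase _ _ (Finset.mem_univ k)]
    -- Toppling `γ` at `k` lowers `z k` by `γ` and leaves the other factors alone, so averaging over
    -- `γ` is the renewal inequality in the `k`-th factor.
    refine le_trans ?_ (mul_le_mul_of_nonneg_right
      (sum_uniformRenewalInt_sub_le P.I.toNat (z k)) (prod_nonneg _ z))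
    rw [Int.toNat_of_nonneg hI.le, Finset.sum_mul]
    refine Finset.sum_le_sum fun γ hγ => ?_
    rw [div_mul_eq_mul_div]
    refine div_le_div_of_nonneg_right ?_ (Nat.cast_nonneg _)
    refine (ih γ hγ y (z + -Pi.single k γ) ?_).trans_eq ?_
    · rw [topple_eq_sub_lap, hr, lap_add, lap_neg, sub_eq_add_neg, add_assoc]
    · rw [← Finset.mul_prod_erase _ _ (Finset.mem_univ k)]
      congr 1
      · simp [sub_eq_add_neg]
      · refine Finset.prod_congr rfl fun j hj => ?_
        rw [Pi.add_apply, Pi.neg_apply, Pi.single_eq_of_ne (Finset.ne_of_mem_erase hj), neg_zero,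
          add_zero]

/-- In the steady state no configuration is likely. -/
theorem IsSteadyState.apply_le {P : Params} {g : PMF (Config n)} (hg : IsSteadyState P g)
    (y : Config n) : (g y).toReal ≤ (2 / ((P.I : ℝ) + 1)) ^ (n - 1) := by
  have hI := P.I_pos
  obtain ⟨I, hPI⟩ : ∃ I : ℕ, P.I = I := ⟨P.I.toNat, by omega⟩
  have hI0 : 0 < I := by omega
  have hIr : (P.I : ℝ) = I := by rw [hPI]; simp
  have hIn : P.I.toNat = I := by omega
  set q : ℝ := (2 / ((P.I : ℝ) + 1)) ^ (n - 1) with hq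
  have hq0 : 0 ≤ q := by rw [hq, hIr]; positivity
  set V : Finset (Fin (n - 1) → ℕ) := Fintype.piFinset fun _ => Finset.range I with hV
  set p : (Fin (n - 1) → ℕ) → ℝ := fun v => ∏ k, stationaryDelay I (v k) with hp
  have hp0 : ∀ v, 0 ≤ p v := fun v => Finset.prod_nonneg fun _ _ => stationaryDelay_nonneg _ _
  have hp1 : ∑ v ∈ V, p v = 1 := by
    rw [hV, hp, Finset.sum_prod_piFinset (Finset.range I) fun _ => stationaryDelay I]
    simp [sum_stationaryDelay I hI0]
  -- Independent stationary delays at all vertices.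
  set d : PMF (Fin (n - 1) → ℕ) := PMF.ofFinset
    (fun v => if v ∈ V then ENNReal.ofReal (p v) else 0) V
    (by
      rw [Finset.sum_congr rfl fun v hv => if_pos hv,
        ← ENNReal.ofReal_sum_of_nonneg fun v _ => hp0 v, hp1, ENNReal.ofReal_one])
    (fun v hv => if_neg hv) with hd
  have hdV : ∀ v ∉ V, d v = 0 := fun v hv => by rw [hd, PMF.ofFinset_apply, if_neg hv]
  have hdp : ∀ v ∈ V, (d v).toReal = p v := fun v hv => by
    rw [hd, PMF.ofFinset_apply, if_pos hv, ENNReal.toReal_ofReal (hp0 v)]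
  -- Adding `-lap v` shifts the amounts still to be toppled by `-v`. Since `v k < I`, it lowers no
  -- height by more than `2I`, which the constant compensates.
  set s : (Fin (n - 1) → ℕ) → Config n :=
    fun v => (fun _ => 2 * P.I) + lap (-fun k => (v k : ℤ)) with hs
  have hs0 : ∀ v ∈ V, ∀ k, 0 ≤ s v k := fun v hv k => by
    have hv0 := extend_nonneg (z := fun k => (v k : ℤ)) fun k => Int.natCast_nonneg _
    have h1 := hv0 k
    have h2 := hv0 (k + 2)
    have h3 := Finset.mem_range.1 (Fintype.mem_piFinset.1 hv k)
    simp only [hs, lap_neg, Pi.add_apply, Pi.neg_apply, lap, extend_succ]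
    omega
  have hf : Nonneg (d.bind fun v => PMF.pure (s v)) := by
    have hsub : ∀ r ∈ (d.bind fun v => PMF.pure (s v)).support, ∃ v ∈ V, r = s v := fun r hr => by
      obtain ⟨v, hv, hr⟩ := (PMF.mem_support_bind_iff _ _ _).1 hr
      rw [PMF.support_pure, Set.mem_singleton_iff] at hr
      exact ⟨v, not_imp_comm.1 (hdV v) hv, hr⟩
    constructor
    · refine (V.finite_toSet.image s).subset fun r hr => ?_
      obtain ⟨v, hv, rfl⟩ := hsub r hr
      exact ⟨v, hv, rfl⟩
    · intro r hr k
      obtain ⟨v, hv, rfl⟩ := hsub r hr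
      exact hs0 v hv k
  have key : ∀ r : Config n,
      ((d.bind fun v => stabilize P (r + s v)) y).toReal ≤ q := fun r => by
    rw [PMF.bind_apply_toReal _ _ V hdV]
    -- If `y` is reachable for one delay `v₀`, then `r + 2I = y + lap c` with `c` free of `v`, and
    -- so `r + s v = y + lap (c - v)` for every `v`.
    by_cases hex : ∃ v₀ ∈ V, stabilize P (r + s v₀) y ≠ 0
    · obtain ⟨v₀, -, hv₀⟩ := hex
      obtain ⟨z, hz⟩ := (isOutput_stabilize P _).exists_eq_add_lap y hv₀
      set c : Fin (n - 1) → ℤ := z + fun k => (v₀ k : ℤ) with hc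
      have hr : r + (fun _ => 2 * P.I) = y + lap c := by
        rw [hs, ← add_assoc, lap_neg, ← sub_eq_add_neg, sub_eq_iff_eq_add] at hz
        rw [hz, hc, lap_add, add_assoc]
      calc ∑ v ∈ V, (d v).toReal * (stabilize P (r + s v) y).toReal
          ≤ ∑ v ∈ V, ∏ k, stationaryDelay I (v k) * uniformRenewalInt I (c k - v k) := by
            refine Finset.sum_le_sum fun v hv => ?_
            rw [hdp v hv, Finset.prod_mul_distrib]
            refine mul_le_mul_of_nonneg_left ?_ (hp0 v)
            have := (isOutput_stabilize P (r + s v)).apply_le_prod y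
              (c + -fun k => (v k : ℤ)) (by
                rw [hs, ← add_assoc, hr, lap_add c, add_assoc])
            rw [hIn] at this
            simpa [sub_eq_add_neg] using this
        _ = ∏ k, ∑ v ∈ Finset.range I, stationaryDelay I v * uniformRenewalInt I (c k - v) :=
            Finset.sum_prod_piFinset (Finset.range I)
              fun k v => stationaryDelay I v * uniformRenewalInt I (c k - v)
        _ ≤ ∏ _k : Fin (n - 1), 2 / ((I : ℝ) + 1) :=
            Finset.prod_le_prod (fun k _ => Finset.sum_nonneg fun v _ =>
              mul_nonneg (stationaryDelay_nonneg _ _) (uniformRenewalInt_nonneg _ _))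
              fun k _ => sum_stationaryDelay_mul_le I hI0 (c k)
        _ = q := by simp [hq, hIr, div_pow]
    · push Not at hex
      rw [Finset.sum_eq_zero fun v hv => by rw [hex v hv, ENNReal.toReal_zero, mul_zero]]
      exact hq0
  rw [← hg _ hf]
  simp only [oplus, PMF.bind_bind, PMF.pure_bind]
  rw [PMF.bind_apply_toReal _ _ (window P n) fun x hx => hg.apply_eq_zero hx]
  calc _ ≤ ∑ r ∈ window P n, (g r).toReal * q :=
        Finset.sum_le_sum fun r _ => mul_le_mul_of_nonneg_left (key r) ENNReal.toReal_nonneg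
    _ = q := by
        rw [← Finset.sum_mul, g.sum_toReal_eq_one _ fun x hx => hg.apply_eq_zero hx, one_mul]

/-- If `g` were concentrated at `y`, then `y + e` with one grain at the first vertex could stabilize
to `y`, making `e` a Laplacian; but its weighted sum is 1, not divisible by `n ≥ 2`. -/
theorem IsSteadyState.isMixed {P : Params} (hn : 2 ≤ n) {g : PMF (Config n)}
    (hg : IsSteadyState P g) : IsMixed g := by
  refine ⟨hg.nonneg.1, ?_⟩
  by_contra hnt
  obtain ⟨y, hy⟩ := g.support_nonempty
  have hsub : ∀ x ∈ g.support, x = y := fun x hx =>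
    (Set.not_nontrivial_iff.1 hnt) hx hy
  have hn1 : 0 < n - 1 := by omega
  set e : Config n := Pi.single ⟨0, hn1⟩ 1 with he
  have he0 : ∀ k, 0 ≤ e k := fun k => by
    rw [he, Pi.single_apply]; split_ifs <;> norm_num
  have hfix := hg _ (nonneg_pure he0)
  have hy' := hy
  rw [← hfix, oplus, PMF.mem_support_bind_iff] at hy'
  obtain ⟨x, hx, hy'⟩ := hy'
  rw [PMF.pure_bind, hsub x hx] at hy'
  obtain ⟨z, hz⟩ := (isOutput_stabilize P _).exists_eq_add_lap y hy'
  have hd := dvd_sum_mul_lap z (by omega)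
  rw [← add_left_cancel hz, he, Finset.sum_eq_single ⟨0, hn1⟩
    (fun j _ hj => by rw [Pi.single_eq_of_ne hj, mul_zero])
    fun h => absurd (Finset.mem_univ _) h] at hd
  simp only [Pi.single_eq_same, Nat.cast_zero, zero_add, mul_one] at hd
  have := Int.le_of_dvd one_pos hd
  omega

end SSP

/-! ### Large deviations of `logRHF` below its worst case -/

namespace SSP

variable {n : ℕ}

/-- The worst case of `logRHF`. -/
noncomputable def maxLogRHF (P : Params) (n : ℕ) : ℝ := (P.T : ℝ) * ((n : ℝ) - 1) / (2 * n)

/-- How far `logRHF r` stays below the worst case. -/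
noncomputable def deficit (P : Params) (r : Config n) : ℝ := maxLogRHF P n - logRHF r

theorem deficit_eq (P : Params) (hn : 2 ≤ n) (r : Config n) :
    deficit P r = 1 / (n : ℝ) ^ 2
      * ∑ i : Fin (n - 1), ((n : ℝ) - ((i.val : ℝ) + 1)) * ((P.T : ℝ) - r i) := by
  have hsum : ∀ m : ℕ, ∑ i ∈ Finset.range m, ((n : ℝ) - ((i : ℝ) + 1))
      = m * n - m * (m + 1) / 2 := fun m => by
    induction m with
    | zero => simp
    | succ m ih =>
      rw [Finset.sum_range_succ, ih]
      push_cast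
      ring
  have hn0 : (n : ℝ) ≠ 0 := by positivity
  have hn1 : ((n - 1 : ℕ) : ℝ) = n - 1 := by
    rw [Nat.cast_sub (by omega), Nat.cast_one]
  have hsplit : ∑ i : Fin (n - 1), ((n : ℝ) - ((i.val : ℝ) + 1)) * ((P.T : ℝ) - r i)
      = (∑ i : Fin (n - 1), ((n : ℝ) - ((i.val : ℝ) + 1))) * P.T
        - ∑ i : Fin (n - 1), ((n : ℝ) - ((i.val : ℝ) + 1)) * r i := by
    rw [Finset.sum_mul, ← Finset.sum_sub_distrib]
    exact Finset.sum_congr rfl fun i _ => mul_sub _ _ _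
  rw [hsplit, deficit, logRHF, maxLogRHF,
    Fin.sum_univ_eq_sum_range fun i : ℕ => (n : ℝ) - ((i : ℝ) + 1), hsum, hn1]
  field_simp
  ring

theorem deficit_nonneg {P : Params} (hn : 2 ≤ n) {r : Config n} (hr : Stable P r) :
    0 ≤ deficit P r := by
  rw [deficit_eq P hn]
  refine mul_nonneg (by positivity) (Finset.sum_nonneg fun i _ => mul_nonneg ?_ ?_)
  · have hi : i.val + 1 ≤ n := by have := i.isLt; omega
    have : ((i.val + 1 : ℕ) : ℝ) ≤ n := Nat.cast_le.2 hi
    push_cast at this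
    linarith
  · exact sub_nonneg.2 (Int.cast_le.2 (hr i))

theorem isGreatest_logRHF (P : Params) (hn : 2 ≤ n) :
    IsGreatest (logRHF '' outputs P n) (maxLogRHF P n) := by
  constructor
  · have hs : Stable P (fun _ : Fin (n - 1) => P.T) := fun _ => le_rfl
    refine ⟨fun _ => P.T, ⟨fun _ => P.T, ?_⟩, ?_⟩
    · rw [stabilize_of_stable hs]
      simp
    · have h := deficit_eq P hn fun _ => P.T
      simp only [sub_self, mul_zero, Finset.sum_const_zero] at h
      exact (sub_eq_zero.1 h).symm
  · rintro _ ⟨y, ⟨r, hy⟩, rfl⟩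
    have h := deficit_nonneg hn ((isOutput_stabilize P r).stable_of_mem_support y hy)
    exact sub_nonneg.1 h

theorem isGreatest_RHF (P : Params) (hn : 2 ≤ n) :
    IsGreatest (RHF '' outputs P n) (Real.exp (maxLogRHF P n)) := by
  have h := (Real.exp_strictMono.monotone).map_isGreatest (isGreatest_logRHF P hn)
  rwa [Set.image_image] at h

/-- The probability under `g` that `logRHF` is within `a` of the worst case. -/
noncomputable def nearWorst (P : Params) (g : PMF (Config n)) (a : ℝ) : ℝ :=
  ∑ r ∈ (window P n).filter (fun r => deficit P r < a), (g r).toReal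

theorem IsSteadyState.mean_le {P : Params} {g : PMF (Config n)} (hg : IsSteadyState P g)
    {F : Config n → ℝ} {A B a : ℝ}
    (hF : ∀ r ∈ window P n, F r ≤ A + if deficit P r < a then B else 0) :
    mean g F ≤ A + B * nearWorst P g a := by
  have h0 : ∀ x ∉ window P n, g x = 0 := fun x hx => hg.apply_eq_zero hx
  rw [mean, tsum_eq_sum (s := window P n) fun x hx => by simp [h0 x hx]]
  calc ∑ r ∈ window P n, (g r).toReal * F r
      ≤ ∑ r ∈ window P n, (g r).toReal * (A + if deficit P r < a then B else 0) :=
        Finset.sum_le_sum fun r hr => mul_le_mul_of_nonneg_left (hF r hr) ENNReal.toReal_nonneg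
    _ = A + B * nearWorst P g a := by
        simp only [mul_add, Finset.sum_add_distrib, ← Finset.sum_mul, g.sum_toReal_eq_one _ h0,
          one_mul, mul_ite, mul_zero]
        rw [← Finset.sum_filter, ← Finset.sum_mul, nearWorst, mul_comm B]

/-- Exponential Markov inequality for the deficit, combined with the uniform bound on the
probabilities of the configurations. -/
theorem IsSteadyState.nearWorst_le {P : Params} (hn : 2 ≤ n) {g : PMF (Config n)}
    (hg : IsSteadyState P g) (a : ℝ) {β : ℝ} (hβ : 0 ≤ β) :
    nearWorst P g a ≤ Real.exp (β * a * n) * ∏ w ∈ Finset.range (n - 1),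
      (2 / ((P.I : ℝ) + 1) *
        ∑ x ∈ Finset.range (2 * P.I.toNat), Real.exp (-(β * ((w : ℝ) + 1) / n)) ^ x) := by
  have hI := P.I_pos
  have hI' : (0 : ℝ) < P.I := Int.cast_pos.2 hI
  have hn0 : (0 : ℝ) < n := by positivity
  set q : ℝ := 2 / ((P.I : ℝ) + 1) with hq
  have hq0 : 0 ≤ q := by positivity
  have hexp : ∀ r : Config n, Real.exp (β * n * (a - deficit P r)) = Real.exp (β * a * n)
      * ∏ i : Fin (n - 1), Real.exp (-(β * ((n : ℝ) - ((i.val : ℝ) + 1)) / n) * (P.T - r i)) := by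
    intro r
    rw [← Real.exp_sum, ← Real.exp_add, deficit_eq P hn, Finset.mul_sum, mul_sub, Finset.mul_sum,
      sub_eq_add_neg, ← Finset.sum_neg_distrib]
    congr 2
    · ring
    · refine Finset.sum_congr rfl fun i _ => ?_
      field_simp
  have hgeom : ∀ t : ℝ, ∑ m ∈ Finset.Ioc (P.T - 2 * P.I) P.T, Real.exp (-t * (P.T - m))
      = ∑ x ∈ Finset.range (2 * P.I.toNat), Real.exp (-t) ^ x := by
    intro t
    refine Finset.sum_bij' (fun m _ => (P.T - m).toNat) (fun x _ => P.T - x) ?_ ?_ ?_ ?_ ?_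
    · intro m hm
      have := Finset.mem_Ioc.1 hm
      rw [Finset.mem_range]
      omega
    · intro x hx
      have := Finset.mem_range.1 hx
      rw [Finset.mem_Ioc]
      omega
    · intro m hm
      have := Finset.mem_Ioc.1 hm
      omega
    · intro x hx
      omega
    · intro m hm
      have hm' := Finset.mem_Ioc.1 hm
      have h1 : (((P.T - m).toNat : ℕ) : ℝ) = P.T - m := by
        rw [← Int.cast_natCast, Int.toNat_of_nonneg (by omega), Int.cast_sub]
      rw [← Real.exp_nat_mul, h1, mul_comm]
  calc nearWorst P g a
      ≤ ∑ r ∈ (window P n).filter (fun r => deficit P r < a),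
          q ^ (n - 1) * Real.exp (β * n * (a - deficit P r)) := by
        refine Finset.sum_le_sum fun r hr => (hg.apply_le r).trans ?_
        refine le_mul_of_one_le_right (pow_nonneg hq0 _) (Real.one_le_exp ?_)
        exact mul_nonneg (by positivity) (sub_nonneg.2 (Finset.mem_filter.1 hr).2.le)
    _ ≤ ∑ r ∈ window P n, q ^ (n - 1) * Real.exp (β * n * (a - deficit P r)) :=
        Finset.sum_le_sum_of_subset_of_nonneg (Finset.filter_subset _ _)
          fun _ _ _ => by positivity
    -- The window is a box and the deficit is linear, so the sum factors into geometric sums over `T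
    -- - r i`.
    _ = Real.exp (β * a * n) * (q ^ (n - 1) * ∏ i : Fin (n - 1),
          ∑ x ∈ Finset.range (2 * P.I.toNat),
            Real.exp (-(β * ((n : ℝ) - ((i.val : ℝ) + 1)) / n)) ^ x) := by
        simp only [hexp, ← hgeom]
        rw [← Finset.sum_prod_piFinset (Finset.Ioc (P.T - 2 * P.I) P.T) fun (i : Fin (n - 1)) m =>
          Real.exp (-(β * ((n : ℝ) - ((i.val : ℝ) + 1)) / n) * (P.T - m))]
        rw [← Finset.mul_sum, ← Finset.mul_sum, window]
        ring
    _ = _ := by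
        congr 1
        rw [Finset.prod_mul_distrib, Finset.prod_const, Finset.card_range]
        congr 1
        rw [Fin.prod_univ_eq_prod_range fun i : ℕ => ∑ x ∈ Finset.range (2 * P.I.toNat),
          Real.exp (-(β * ((n : ℝ) - ((i : ℝ) + 1)) / n)) ^ x, ← Finset.prod_range_reflect]
        refine Finset.prod_congr rfl fun w hw => ?_
        have hw' := Finset.mem_range.1 hw
        have : ((n - 1 - 1 - w : ℕ) : ℝ) = n - 2 - w := by
          rw [show n - 1 - 1 - w = n - (2 + w) by omega, Nat.cast_sub (by omega)]
          push_cast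
          ring
        rw [this, show (n : ℝ) - ((n : ℝ) - 2 - w + 1) = w + 1 by ring]

theorem geom_exp_le {t : ℝ} (ht : 0 < t) (m : ℕ) :
    ∑ x ∈ Finset.range m, Real.exp (-t) ^ x ≤ 1 + 1 / t := by
  have h1 : Real.exp (-t) ≤ 1 / (1 + t) := by
    rw [Real.exp_neg, ← one_div]
    exact one_div_le_one_div_of_le (by positivity) (by linarith [Real.add_one_le_exp t])
  have h2 : t / (1 + t) ≤ 1 - Real.exp (-t) := by
    have : t / (1 + t) = 1 - 1 / (1 + t) := by field_simp; ring
    linarith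
  have h3 : 0 < t / (1 + t) := by positivity
  rw [geom_sum_eq (by linarith), ← neg_div_neg_eq, neg_sub, neg_sub,
    show 1 + 1 / t = 1 / (t / (1 + t)) by field_simp; ring]
  exact div_le_div₀ zero_le_one (by linarith [pow_nonneg (Real.exp_nonneg (-t)) m]) h3 h2

/-- Unlike `geom_exp_le`, this keeps the factor due to truncation at `m` terms, the sole source of
exponential decay at the critical `a = I / (2 e²)`. -/
theorem geom_exp_le' {t : ℝ} (ht : 0 < t) (m : ℕ) :
    ∑ x ∈ Finset.range m, Real.exp (-t) ^ x ≤ (1 - Real.exp (-(m * t))) * Real.exp t / t := by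
  have h2 : t / Real.exp t ≤ 1 - Real.exp (-t) := by
    rw [Real.exp_neg, div_le_iff₀ (Real.exp_pos t), sub_mul, one_mul,
      inv_mul_cancel₀ (Real.exp_pos t).ne']
    linarith [Real.add_one_le_exp t]
  have h3 : 0 < t / Real.exp t := by positivity
  have h4 : 0 ≤ 1 - Real.exp (-(m * t)) := by
    rw [sub_nonneg, Real.exp_le_one_iff, neg_nonpos]
    positivity
  rw [geom_sum_eq (by linarith), ← neg_div_neg_eq, neg_sub, neg_sub, ← Real.exp_nat_mul,
    mul_neg, ← div_div_eq_mul_div]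
  exact div_le_div_of_nonneg_left h4 h3 h2

/-- Used with `s` of order `√(n / (w + 1))`, whose sum over `w` is linear in `n`; the bound `1 + x ≤
exp x` would cost a logarithm. -/
theorem one_add_sq_le_exp {s : ℝ} (hs : 0 ≤ s) : 1 + s ^ 2 ≤ Real.exp s := by
  have h := Real.sum_le_exp_of_nonneg hs 4
  simp only [Finset.sum_range_succ, Finset.sum_range_zero, Nat.factorial] at h
  norm_num at h
  nlinarith [mul_nonneg hs (sq_nonneg (2 * s - 3))]

theorem sum_inv_sqrt_le (m : ℕ) :
    ∑ w ∈ Finset.range m, 1 / √((w : ℝ) + 1) ≤ 2 * √m := by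
  induction m with
  | zero => simp
  | succ m ih =>
    rw [Finset.sum_range_succ]
    push_cast
    have h1 : 0 < √((m : ℝ) + 1) := Real.sqrt_pos.2 (by positivity)
    have h2 := Real.sq_sqrt (show (0 : ℝ) ≤ (m : ℝ) + 1 by positivity)
    have h3 := Real.sq_sqrt (Nat.cast_nonneg (α := ℝ) m)
    have h4 : 1 / √((m : ℝ) + 1) ≤ 2 * √((m : ℝ) + 1) - 2 * √m := by
      rw [div_le_iff₀ h1]
      nlinarith [sq_nonneg (√((m : ℝ) + 1) - √m)]
    linarith

/-- For `I ≥ 2`, configurations that are almost worst-case have exponentially small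
probability. -/
theorem IsSteadyState.nearWorst_le_of_two_le {P : Params} (hI : 2 ≤ P.I) (hn : 2 ≤ n)
    {g : PMF (Config n)} (hg : IsSteadyState P g) :
    nearWorst P g (1 / 4000) ≤ 5 / 4 * (5 / 6) ^ (n - 1) := by
  have hn0 : (0 : ℝ) < n := by positivity
  have hI' : (2 : ℝ) ≤ P.I := by exact_mod_cast hI
  have hq : 2 / ((P.I : ℝ) + 1) ≤ 2 / 3 :=
    div_le_div_of_nonneg_left (by norm_num) (by norm_num) (by linarith)
  have he : Real.exp (1 / 5) ≤ 5 / 4 := by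
    refine le_of_pow_le_pow_left₀ (n := 5) (by norm_num) (by norm_num) ?_
    rw [← Real.exp_nat_mul]
    have := Real.exp_one_lt_d9
    norm_num at this ⊢
    linarith
  -- The prefactor and the geometric sums each cost at most `exp (n / 10)`, together at most `(5 /
  -- 4) ^ n`, while `I ≥ 2` gains `(2 / 3) ^ (n - 1)`; and `2 / 3 * (5 / 4) = 5 / 6`.
  refine (hg.nearWorst_le hn (1 / 4000) (β := 400) (by norm_num)).trans ?_
  have hfac : ∀ w ∈ Finset.range (n - 1), 2 / ((P.I : ℝ) + 1) *
      ∑ x ∈ Finset.range (2 * P.I.toNat), Real.exp (-(400 * ((w : ℝ) + 1) / n)) ^ x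
      ≤ 2 / 3 * Real.exp (√n / 20 * (1 / √((w : ℝ) + 1))) := by
    intro w _
    have ht : 0 < 400 * ((w : ℝ) + 1) / n := by positivity
    refine mul_le_mul hq ((geom_exp_le ht _).trans ?_)
      (Finset.sum_nonneg fun _ _ => by positivity) (by norm_num)
    refine le_trans (le_of_eq ?_) (one_add_sq_le_exp (by positivity))
    rw [mul_pow, div_pow, div_pow, Real.sq_sqrt hn0.le, Real.sq_sqrt (by positivity)]
    field_simp
    ring
  have hsum : ∑ w ∈ Finset.range (n - 1), √n / 20 * (1 / √((w : ℝ) + 1)) ≤ n / 10 := by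
    rw [← Finset.mul_sum]
    have h1 : √((n - 1 : ℕ) : ℝ) ≤ √n := Real.sqrt_le_sqrt (Nat.cast_le.2 (Nat.sub_le n 1))
    calc √n / 20 * ∑ w ∈ Finset.range (n - 1), 1 / √((w : ℝ) + 1)
        ≤ √n / 20 * (2 * √n) :=
          mul_le_mul_of_nonneg_left ((sum_inv_sqrt_le _).trans (by linarith)) (by positivity)
      _ = n / 10 := by
          have := Real.mul_self_sqrt hn0.le
          linarith
  calc _ ≤ Real.exp (400 * (1 / 4000) * n) * ∏ w ∈ Finset.range (n - 1),
          (2 / 3 * Real.exp (√n / 20 * (1 / √((w : ℝ) + 1)))) := by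
        refine mul_le_mul_of_nonneg_left (Finset.prod_le_prod (fun w _ => ?_) hfac)
          (Real.exp_nonneg _)
        exact mul_nonneg (by positivity) (Finset.sum_nonneg fun _ _ => by positivity)
    _ = (2 / 3) ^ (n - 1) * Real.exp (400 * (1 / 4000) * n
          + ∑ w ∈ Finset.range (n - 1), √n / 20 * (1 / √((w : ℝ) + 1))) := by
        rw [Finset.prod_mul_distrib, Finset.prod_const, Finset.card_range, ← Real.exp_sum,
          Real.exp_add]
        ring
    _ ≤ (2 / 3) ^ (n - 1) * Real.exp (n * (1 / 5)) := by
        refine mul_le_mul_of_nonneg_left (Real.exp_le_exp.2 ?_) (by positivity)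
        linarith
    _ ≤ (2 / 3) ^ (n - 1) * (5 / 4) ^ n := by
        rw [Real.exp_nat_mul]
        exact mul_le_mul_of_nonneg_left (pow_le_pow_left₀ (Real.exp_nonneg _) he n)
          (by positivity)
    _ = 5 / 4 * (5 / 6) ^ (n - 1) := by
        obtain ⟨m, rfl⟩ : ∃ m, n = m + 1 := ⟨n - 1, by omega⟩
        rw [Nat.add_sub_cancel, pow_succ, ← mul_assoc, ← mul_pow, mul_comm]
        norm_num

/-- Configurations with deficit below `I / (2 e²)` have exponentially small probability
as soon as `I` is large. -/
theorem IsSteadyState.nearWorst_le_of_large {P : Params} {κ ρ : ℝ}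
    (hκ : κ = 1 - Real.exp (-(4 * Real.exp 2)))
    (hρ : κ * Real.exp (2 * Real.exp 2 / P.I) ≤ ρ) (hn : 2 ≤ n)
    {g : PMF (Config n)} (hg : IsSteadyState P g) :
    nearWorst P g (P.I / (2 * Real.exp 2)) ≤ Real.exp 2 * ρ ^ (n - 1) := by
  have hI : (0 : ℝ) < P.I := Int.cast_pos.2 P.I_pos
  have hn0 : (0 : ℝ) < n := by positivity
  have he := Real.exp_pos 2
  set E := Real.exp 2 with hE
  have hκ0 : 0 ≤ κ := by
    rw [hκ, sub_nonneg, Real.exp_le_one_iff]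
    linarith
  have hρ0 : 0 ≤ ρ := le_trans (by positivity) hρ
  -- This `β` makes `β * a = 1`. The prefactor `exp n` and `n ^ (n - 1) / (n - 1)! ≤ exp n` then
  -- cancel `E ^ (n - 1)` up to one factor `E`, leaving `ρ ^ (n - 1)`.
  refine (hg.nearWorst_le hn (P.I / (2 * E)) (β := 2 * E / P.I) (by positivity)).trans ?_
  rw [show 2 * E / P.I * (P.I / (2 * E)) * n = n by field_simp]
  have hcast : ((2 * P.I.toNat : ℕ) : ℝ) = 2 * P.I := by
    rw [Nat.cast_mul, ← Int.cast_natCast P.I.toNat, Int.toNat_of_nonneg P.I_pos.le]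
    norm_num
  have hfac : ∀ w ∈ Finset.range (n - 1), 2 / ((P.I : ℝ) + 1) *
      ∑ x ∈ Finset.range (2 * P.I.toNat), Real.exp (-(2 * E / P.I * ((w : ℝ) + 1) / n)) ^ x
      ≤ ρ / E * (n / ((w : ℝ) + 1)) := by
    intro w hw
    have hw1 : (w : ℝ) + 1 ≤ n := by
      have : w + 1 ≤ n := by have := Finset.mem_range.1 hw; omega
      exact_mod_cast this
    set t := 2 * E / P.I * ((w : ℝ) + 1) / n with ht
    have ht0 : 0 < t := by positivity
    have htle : t ≤ 2 * E / P.I := by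
      rw [ht, mul_div_assoc]
      exact mul_le_of_le_one_right (by positivity) ((div_le_one hn0).2 hw1)
    have h1 : 1 - Real.exp (-((2 * P.I.toNat : ℕ) * t)) ≤ κ := by
      rw [hκ, hcast]
      refine sub_le_sub_left (Real.exp_le_exp.2 (neg_le_neg ?_)) _
      calc 2 * (P.I : ℝ) * t ≤ 2 * P.I * (2 * E / P.I) :=
            mul_le_mul_of_nonneg_left htle (by positivity)
        _ = 4 * E := by field_simp; norm_num
    have h2 : (1 - Real.exp (-((2 * P.I.toNat : ℕ) * t))) * Real.exp t ≤ ρ :=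
      (mul_le_mul h1 (Real.exp_le_exp.2 htle) (Real.exp_nonneg _) hκ0).trans hρ
    calc _ ≤ 2 / (P.I : ℝ) * (ρ / t) := by
          refine mul_le_mul ?_ ((geom_exp_le' ht0 _).trans ?_)
            (Finset.sum_nonneg fun _ _ => by positivity) (by positivity)
          · exact div_le_div_of_nonneg_left (by norm_num) hI (by linarith)
          · exact div_le_div_of_nonneg_right h2 ht0.le
      _ = ρ / E * (n / ((w : ℝ) + 1)) := by
          rw [ht]
          field_simp
  calc _ ≤ Real.exp n * ∏ w ∈ Finset.range (n - 1), (ρ / E * (n / ((w : ℝ) + 1))) := by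
        refine mul_le_mul_of_nonneg_left (Finset.prod_le_prod (fun w _ => ?_) hfac)
          (Real.exp_nonneg _)
        exact mul_nonneg (by positivity) (Finset.sum_nonneg fun _ _ => by positivity)
    _ = Real.exp n * (ρ / E) ^ (n - 1) * ((n : ℝ) ^ (n - 1) / (n - 1).factorial) := by
        rw [Finset.prod_mul_distrib, Finset.prod_div_distrib (f := fun _ => (n : ℝ)),
          Finset.prod_const,
          Finset.prod_const, Finset.card_range, ← Finset.prod_range_add_one_eq_factorial]
        push_cast
        ring
    _ ≤ Real.exp n * (ρ / E) ^ (n - 1) * Real.exp n :=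
        mul_le_mul_of_nonneg_left (Real.pow_div_factorial_le_exp _ hn0.le _) (by positivity)
    _ = E * ρ ^ (n - 1) := by
        obtain ⟨m, rfl⟩ : ∃ m, n = m + 1 := ⟨n - 1, by omega⟩
        have h : Real.exp ((m + 1 : ℕ) : ℝ) * Real.exp ((m + 1 : ℕ) : ℝ) = E * E ^ m := by
          rw [hE, ← Real.exp_nat_mul, ← Real.exp_add, ← Real.exp_add]
          push_cast
          ring_nf
        rw [Nat.add_sub_cancel, div_pow, mul_right_comm, h]
        field_simp

/-- `√κ` serves as a rate strictly between `κ` and 1. As `κ` is an absolute constant in the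
application, so is `I₀`. -/
theorem exists_forall_mul_exp_le {κ : ℝ} (hκ0 : 0 < κ) (hκ1 : κ < 1) (C : ℝ) :
    ∃ I₀ : ℤ, ∀ I : ℤ, I₀ ≤ I → κ * Real.exp (C / I) ≤ √κ := by
  have hlim : Filter.Tendsto (fun I : ℤ => κ * Real.exp (C / (I : ℝ))) Filter.atTop (nhds κ) := by
    have h1 : Filter.Tendsto (fun I : ℤ => C / (I : ℝ)) Filter.atTop (nhds 0) :=
      tendsto_const_nhds.div_atTop tendsto_intCast_atTop_atTop
    have h2 := ((Real.continuous_exp.tendsto 0).comp h1).const_mul κ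
    rwa [Real.exp_zero, mul_one] at h2
  have hlt : κ < √κ := by
    rw [Real.lt_sqrt hκ0.le]
    nlinarith
  exact Filter.eventually_atTop.1 ((hlim.eventually (gt_mem_nhds hlt)).mono fun _ h => h.le)

theorem maxLogRHF_eq (P : Params) (hn : 2 ≤ n) :
    maxLogRHF P n = (P.T : ℝ) / 2 + -((P.T : ℝ) / 2 / n) := by
  have hn0 : (0 : ℝ) < n := by positivity
  unfold maxLogRHF
  field_simp
  ring

theorem T_pos (P : Params) : (0 : ℝ) < P.T := by
  have h1 := P.I_pos
  have h2 := P.two_mul_I_le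
  exact Int.cast_pos.2 (by omega)

theorem tendsto_pow_sub_one {ρ : ℝ} (h0 : 0 ≤ ρ) (h1 : ρ < 1) (C : ℝ) :
    Filter.Tendsto (fun n : ℕ => C * ρ ^ (n - 1)) Filter.atTop (nhds 0) := by
  have := ((tendsto_pow_atTop_nhds_zero_of_lt_one h0 h1).comp
    (Filter.tendsto_sub_atTop_nat 1)).const_mul C
  rwa [mul_zero] at this

end SSP

/-! ### Assembly of the four statements -/

theorem theorem3p1 :
    -- there is a unique steady state, and it is a mixed configuration
    (∀ (P : SSP.Params) (n : ℕ), 2 ≤ n →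
      (∃! g : PMF (SSP.Config n), SSP.IsSteadyState P g) ∧
      ∀ g : PMF (SSP.Config n), SSP.IsSteadyState P g → SSP.IsMixed g) ∧
    -- the worst-case log(RHF) is `T / 2 + o(1)`
    (∀ P : SSP.Params, ∃ δ : ℕ → ℝ, Filter.Tendsto δ Filter.atTop (nhds 0) ∧
      ∀ n : ℕ, 2 ≤ n →
        IsGreatest (SSP.logRHF '' SSP.outputs P n) ((P.T : ℝ) / 2 + δ n)) ∧
    -- the average log(RHF) is at most `T / 2 - I / (2e²) + o(1)`
    (∃ I₀ : ℤ, ∀ P : SSP.Params, I₀ ≤ P.I →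
      ∃ δ : ℕ → ℝ, Filter.Tendsto δ Filter.atTop (nhds 0) ∧
        ∀ n : ℕ, 2 ≤ n → ∀ g : PMF (SSP.Config n), SSP.IsSteadyState P g →
          SSP.mean g SSP.logRHF
            ≤ (P.T : ℝ) / 2 - (P.I : ℝ) / (2 * Real.exp 1 ^ 2) + δ n) ∧
    -- the average RHF stays away from the worst-case RHF
    (∀ P : SSP.Params, 2 ≤ P.I → ∃ c : ℝ, 0 < c ∧ ∀ᶠ n : ℕ in Filter.atTop,
      ∃ w : ℝ, IsGreatest (SSP.RHF '' SSP.outputs P n) w ∧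
        ∀ g : PMF (SSP.Config n), SSP.IsSteadyState P g → SSP.mean g SSP.RHF + c ≤ w) := by
  refine ⟨fun P n hn => ⟨?_, fun g hg => hg.isMixed hn⟩, fun P => ?_, ?_, fun P hI => ?_⟩
  · obtain ⟨g, hg⟩ := SSP.exists_isSteadyState P n
    exact ⟨g, hg, fun g' hg' => hg'.eq hg⟩
  · refine ⟨fun n => -((P.T : ℝ) / 2 / n), ?_, fun n hn => ?_⟩
    · have := (tendsto_const_div_atTop_nhds_zero_nat ((P.T : ℝ) / 2)).neg
      rwa [neg_zero] at this
    · rw [← SSP.maxLogRHF_eq P hn]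
      exact SSP.isGreatest_logRHF P hn
  · obtain ⟨κ, hκ⟩ : ∃ κ : ℝ, κ = 1 - Real.exp (-(4 * Real.exp 2)) := ⟨_, rfl⟩
    have he := Real.exp_pos 2
    have hκ0 : 0 < κ := by
      rw [hκ, sub_pos, Real.exp_lt_one_iff]
      linarith
    have hκ1 : κ < 1 := by
      rw [hκ]
      linarith [Real.exp_pos (-(4 * Real.exp 2))]
    obtain ⟨I₀, hI₀⟩ := SSP.exists_forall_mul_exp_le hκ0 hκ1 (2 * Real.exp 2)
    have hE : Real.exp 1 ^ 2 = Real.exp 2 := by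
      rw [← Real.exp_nat_mul]
      norm_num
    refine ⟨I₀, fun P hP => ?_⟩
    have hI : (0 : ℝ) < P.I := Int.cast_pos.2 P.I_pos
    set a : ℝ := P.I / (2 * Real.exp 2) with ha
    have ha0 : 0 < a := by positivity
    refine ⟨fun n => a * Real.exp 2 * √κ ^ (n - 1), SSP.tendsto_pow_sub_one (Real.sqrt_nonneg κ)
      ((Real.sqrt_lt' one_pos).2 (by linarith)) _, fun n hn g hg => ?_⟩
    have hmean : SSP.mean g SSP.logRHF
        ≤ SSP.maxLogRHF P n - a + a * SSP.nearWorst P g a := by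
      refine hg.mean_le fun r hr => ?_
      have h0 := SSP.deficit_nonneg hn fun k => (SSP.mem_window.1 hr k).2
      unfold SSP.deficit at h0 ⊢
      split_ifs with h <;> linarith
    have hnear := mul_le_mul_of_nonneg_left (hg.nearWorst_le_of_large hκ (hI₀ P.I hP) hn) ha0.le
    have hT : 0 ≤ (P.T : ℝ) / 2 / n := by
      have := SSP.T_pos P
      positivity
    have hmax := SSP.maxLogRHF_eq P hn
    rw [hE]
    linarith
  · have ha1 : Real.exp (-(1 / 4000)) < 1 := Real.exp_lt_one_iff.2 (by norm_num)
    -- Outside the near-worst event the loss is at least `W * (1 - exp (-1/4000))`. For large `n`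
    -- that event gives back at most half of this, and `W ≥ 1` makes the other half at least `c`.
    refine ⟨(1 - Real.exp (-(1 / 4000))) / 2, by linarith, ?_⟩
    have hsmall := (SSP.tendsto_pow_sub_one (ρ := 5 / 6) (by norm_num) (by norm_num)
      (5 / 4)).eventually (gt_mem_nhds (show 0 < (1 - Real.exp (-(1 / 4000))) / 2 by linarith))
    filter_upwards [hsmall, Filter.eventually_ge_atTop 2] with n hsm hn
    refine ⟨_, SSP.isGreatest_RHF P hn, fun g hg => ?_⟩
    set W := Real.exp (SSP.maxLogRHF P n) with hW
    have hW1 : 1 ≤ W := by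
      refine Real.one_le_exp ?_
      have hn1 : (1 : ℝ) ≤ n := by exact_mod_cast (by omega : 1 ≤ n)
      have := SSP.T_pos P
      exact div_nonneg (mul_nonneg this.le (sub_nonneg.2 hn1)) (by positivity)
    have hmean : SSP.mean g SSP.RHF
        ≤ W * Real.exp (-(1 / 4000)) + W * SSP.nearWorst P g (1 / 4000) := by
      refine hg.mean_le fun r hr => ?_
      have h0 := SSP.deficit_nonneg hn fun k => (SSP.mem_window.1 hr k).2
      unfold SSP.RHF
      split_ifs with h
      · have h1 : Real.exp (SSP.logRHF r) ≤ W := Real.exp_le_exp.2 (sub_nonneg.1 h0)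
        have h2 : 0 ≤ W * Real.exp (-(1 / 4000)) := by positivity
        linarith
      · rw [add_zero, hW, ← Real.exp_add]
        refine Real.exp_le_exp.2 ?_
        unfold SSP.deficit at h
        linarith
    have hnear := hg.nearWorst_le_of_two_le hI hn
    nlinarith
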